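/- Consider Bernoulli bond percolation on the square lattice: the vertices are the points of $\mathbb{Z}^2$, the edges are the pairs of vertices at Euclidean distance $1$, and under $\mathbb{P}_p$, $p\in[0,1]$, each edge is open with probability $p$, independently of the other edges. Let $\Lambda_n=[-n,n]^2\cap\mathbb{Z}^2$ and $\partial\Lambda_n=\Lambda_n\setminus\Lambda_{n-1}$, and write $0\leftrightarrow\partial\Lambda_n$ for the event that there is a path of open edges from the origin to a vertex of $\partial\Lambda_n$. Let $p_c=\inf\{p\in[0,1]:\mathbb{P}_p[\text{there is an infinite open connected component}]>0\}$. There exists $\alpha>0$ such that, for all integers $n\ge 1$, $$\mathbb{P}_{1/2}[0\leftrightarrow\partial\Lambda_n]\le n^{-\alpha}.$$ Consequently, $\mathbb{P}_{1/2}$-almost surely there is no infinite open connected component, and $p_c\ge 1/2$. -/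

import Mathlib

open MeasureTheory ProbabilityTheory
open scoped unitInterval

namespace Percolation

/-- The square lattice: vertices are the points of `ℤ²`, and `x`, `y` are adjacent exactly when
their Euclidean distance is `1` (equivalently, when its square is `1`). -/
def squareLattice : SimpleGraph (ℤ × ℤ) where
  Adj x y := (x.1 - y.1) ^ 2 + (x.2 - y.2) ^ 2 = 1
  symm := ⟨fun x y h => by linear_combination h⟩
  loopless := ⟨fun x h => by simp at h⟩

/-- Edges of the square lattice, as unordered pairs of adjacent vertices. -/
abbrev Edge : Type := squareLattice.edgeSet

/-- A percolation configuration; `true` means that the edge is open (kept). -/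
abbrev Config : Type := Edge → Bool

/-- Bernoulli percolation of parameter `p`: the edges are open independently of each other,
each with probability `p`. -/
noncomputable def bernoulliPercolation (p : I) : Measure Config :=
  Measure.infinitePi fun _ : Edge => bernoulliMeasure true false p

/-- The random graph on `ℤ²` whose edges are the open edges of `ω`. -/
def openGraph (ω : Config) : SimpleGraph (ℤ × ℤ) :=
  SimpleGraph.fromEdgeSet {e | ∃ h : e ∈ squareLattice.edgeSet, ω ⟨e, h⟩ = true}

/-- The lattice points of the box `[-n, n]²` (empty for `n < 0`). -/
def box (n : ℤ) : Set (ℤ × ℤ) := {x | |x.1| ≤ n ∧ |x.2| ≤ n}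

/-- The boundary `Λ_n \ Λ_{n-1}` of the box `Λ_n`. -/
def boxBoundary (n : ℤ) : Set (ℤ × ℤ) := box n \ box (n - 1)

/-- The event that there is an open path from the set `X` to the set `Y`. -/
def connected (X Y : Set (ℤ × ℤ)) : Set Config :=
  {ω | ∃ x ∈ X, ∃ y ∈ Y, (openGraph ω).Reachable x y}

/-- The event that the random graph has an infinite connected component (infinite cluster). -/
def existsInfiniteCluster : Set Config :=
  {ω | ∃ C : (openGraph ω).ConnectedComponent, C.supp.Infinite}

/-- The critical point of Bernoulli percolation on the square lattice: the infimum, in `[0, 1]`,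
of the parameters at which an infinite cluster exists with positive probability. -/
noncomputable def criticalPoint : I :=
  sInf {p : I | 0 < bernoulliPercolation p existsInfiniteCluster}

/-- The critical point is the only parameter that can separate a phase in which infinite clusters
have probability `0` from a phase in which they have probability `1`. -/
theorem eq_criticalPoint {pc : I}
    (hsub : ∀ p < pc, bernoulliPercolation p existsInfiniteCluster = 0)
    (hsup : ∀ p > pc, bernoulliPercolation p existsInfiniteCluster = 1) :
    pc = criticalPoint := by
  apply le_antisymm
  · refine le_sInf fun p hp => ?_
    by_contra h
    have h0 : 0 < bernoulliPercolation p existsInfiniteCluster := hp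
    exact h0.ne' (hsub p (not_le.mp h))
  · by_contra h
    obtain ⟨q, h1, h2⟩ := exists_between (not_le.mp h)
    refine absurd (sInf_le (?_ : q ∈ {p : I | 0 < bernoulliPercolation p existsInfiniteCluster}))
      (not_le.mpr h2)
    show 0 < bernoulliPercolation q existsInfiniteCluster
    rw [hsup q h1]
    exact one_pos

/-- The parameter `1 / 2`. -/
noncomputable def half : I := ⟨1 / 2, by norm_num, by norm_num⟩

end Percolation

namespace Percolation

/-! The mechanism is self-duality, a Russo–Seymour–Welsh argument, and independence over nested
annuli. Everything is phrased through decreasing events, that is, through the absence of crossings.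
Hence duality is needed in one direction only: an open crossing and a transverse dual open crossing
cannot coexist (`disjoint_hcross_dual_vcross`). At parameter 1/2 the dual has the same law, so a
rectangle one unit longer in the crossing direction is uncrossed with probability at least 1/2
(`half_le_nv`).

To pass from near-squares to longer rectangles, the cluster of the left side of a square is
explored. Beyond it the configuration is fresh, and a reflection argument bounds by 1/4 from below
the chance that no path from the bottom reaches the mirror image of the cluster or the top
(`quarter_le_pr_compl_escape`). The consequence is recast as a decreasing event, `barrier`. The
Harris inequality combines it with its reflection and with an uncrossed square, which gives aspect
ratio about 3/2 (`le_nv_three_halves`). Gluing overlapping rectangles (`nv_glue`) then gives any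
fixed ratio.

Four uncrossed long rectangles block an annulus with probability at least `c ^ 4`, independently of
what happens inside. Each tripling of the scale thus multiplies the arm probability by at most `1 -
c ^ 4`, and polynomial decay follows. An infinite cluster forces arms of every length from some
vertex; countably many vertices and monotonicity in `p` give the other two claims. -/

instance (p : I) : IsProbabilityMeasure (bernoulliPercolation p) := by
  unfold bernoulliPercolation; infer_instance

/-! ### Events determined by finitely many edges -/

/-- Membership in the event `A` is determined by the states of the edges in `F`. -/
def DependsOnEdges (A : Set Config) (F : Set Edge) : Prop :=
  ∀ ω ω' : Config, (∀ e ∈ F, ω e = ω' e) → ω ∈ A → ω' ∈ A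

/-- Extension of a configuration on `F` by closed edges. -/
def extendClosed (F : Finset Edge) (x : F → Bool) : Config := by
  classical exact fun e => if h : e ∈ F then x ⟨e, h⟩ else false

theorem extendClosed_of_mem {F : Finset Edge} (x : F → Bool) {e : Edge} (h : e ∈ F) :
    extendClosed F x e = x ⟨e, h⟩ := by
  simp [extendClosed, h]

theorem extendClosed_mono (F : Finset Edge) : Monotone (extendClosed F) := by
  intro x y hxy e
  by_cases h : e ∈ F
  · simpa [extendClosed, h] using hxy ⟨e, h⟩
  · simp [extendClosed, h]

namespace DependsOnEdges

variable {A B : Set Config} {F G : Set Edge}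

theorem mono (hA : DependsOnEdges A F) (h : F ⊆ G) : DependsOnEdges A G :=
  fun ω ω' hω => hA ω ω' fun e he => hω e (h he)

theorem compl (hA : DependsOnEdges A F) : DependsOnEdges Aᶜ F :=
  fun ω ω' hω hn hA' => hn (hA ω' ω (fun e he => (hω e he).symm) hA')

theorem inter (hA : DependsOnEdges A F) (hB : DependsOnEdges B G) :
    DependsOnEdges (A ∩ B) (F ∪ G) :=
  fun ω ω' hω h => ⟨hA ω ω' (fun e he => hω e (Or.inl he)) h.1,
    hB ω ω' (fun e he => hω e (Or.inr he)) h.2⟩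

/-- Writing a local event as the pullback of a subset of a finite cube makes measurability automatic
and reduces independence to that of coordinates. -/
theorem eq_preimage {F : Finset Edge} (hA : DependsOnEdges A F) :
    A = F.restrict ⁻¹' (extendClosed F ⁻¹' A) := by
  ext ω
  refine ⟨hA _ _ fun e he => ?_, hA _ _ fun e he => ?_⟩
  · rw [extendClosed_of_mem _ he]; rfl
  · rw [extendClosed_of_mem _ he]; rfl

theorem measurableSet (hA : DependsOnEdges A F) (hF : F.Finite) : MeasurableSet A := by
  lift F to Finset Edge using hF
  rw [hA.eq_preimage]
  exact (Finset.measurable_restrict _) (Set.toFinite _).measurableSet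

theorem measureReal_inter (p : I) (hA : DependsOnEdges A F) (hB : DependsOnEdges B G)
    (hF : F.Finite) (hG : G.Finite) (hd : Disjoint F G) :
    (bernoulliPercolation p).real (A ∩ B) =
      (bernoulliPercolation p).real A * (bernoulliPercolation p).real B := by
  lift F to Finset Edge using hF
  lift G to Finset Edge using hG
  have hind : iIndepFun (fun (e : Edge) (ω : Config) => ω e) (bernoulliPercolation p) :=
    iIndepFun_infinitePi (X := fun _ b => b) fun _ => measurable_id
  have h := hind.indepFun_finset F G (by exact_mod_cast hd) fun e => measurable_pi_apply e
  have := h.measure_inter_preimage_eq_mul _ _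
    (Set.toFinite (extendClosed F ⁻¹' A)).measurableSet
    (Set.toFinite (extendClosed G ⁻¹' B)).measurableSet
  change bernoulliPercolation p (F.restrict ⁻¹' _ ∩ G.restrict ⁻¹' _) =
    bernoulliPercolation p (F.restrict ⁻¹' _) * bernoulliPercolation p (G.restrict ⁻¹' _) at this
  rw [← hA.eq_preimage, ← hB.eq_preimage] at this
  rw [measureReal_def, this, ENNReal.toReal_mul]; rfl

end DependsOnEdges

theorem bernoulliMeasure_half_singleton (b : Bool) :
    (bernoulliMeasure true false half) {b} = ENNReal.ofReal (1 / 2) := by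
  have h : σ half = half := by ext; simp [half]; norm_num
  have h' : (unitInterval.toNNReal half : ENNReal) = ENNReal.ofReal (1 / 2) :=
    (ENNReal.ofReal_eq_coe_nnreal half.2.1).symm
  cases b
  · rw [bernoulliMeasure_apply_of_notMem_of_mem _ (MeasurableSet.singleton _) (by simp) (by simp),
      h, h']
  · rw [bernoulliMeasure_apply_of_mem_of_notMem _ (MeasurableSet.singleton _) (by simp) (by simp),
      h']

/-- Bernoulli percolation with parameter `1 / 2`, as a real-valued set function. -/
noncomputable def pr (A : Set Config) : ℝ := (bernoulliPercolation half).real A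

/-- At parameter 1/2 the law on a finite set of edges is uniform, so probabilities are normalized
counts, the form in which the FKG inequality applies. -/
theorem pr_eq_sum {A : Set Config} {F : Finset Edge} (hA : DependsOnEdges A F) [DecidableEq F] :
    pr A = (1 / 2) ^ F.card * ∑ x : F → Bool, (extendClosed F ⁻¹' A).indicator 1 x := by
  classical
  have h1 : pr A = (Measure.pi fun _ : F => bernoulliMeasure true false half).real
      (extendClosed F ⁻¹' A) := by
    rw [pr]
    conv_lhs => rw [hA.eq_preimage]
    rw [bernoulliPercolation, measureReal_def, measureReal_def, ← Measure.map_apply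
      (Finset.measurable_restrict _) (Set.toFinite _).measurableSet,
      Measure.infinitePi_map_restrict]
  rw [h1, ← (Set.toFinite (extendClosed F ⁻¹' A)).coe_toFinset,
    ← sum_measureReal_singleton, Finset.mul_sum]
  simp_rw [Set.indicator_apply, Finset.mem_coe, mul_ite, mul_zero]
  rw [Finset.sum_ite_mem, Finset.univ_inter]
  refine Finset.sum_congr rfl fun x _ => ?_
  rw [measureReal_def, Measure.pi_singleton]
  simp [bernoulliMeasure_half_singleton]

theorem pr_nonneg (A : Set Config) : 0 ≤ pr A := measureReal_nonneg

theorem pr_mono {A B : Set Config} (h : A ⊆ B) : pr A ≤ pr B := measureReal_mono h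

/-! ### Positive correlation of decreasing events -/

/-- A decreasing event that depends on finitely many edges. -/
structure IsDecreasing (A : Set Config) : Prop where
  exists_finite : ∃ F : Set Edge, F.Finite ∧ DependsOnEdges A F
  isLowerSet : IsLowerSet A

namespace IsDecreasing

variable {A B : Set Config}

theorem measurableSet (hA : IsDecreasing A) : MeasurableSet A := by
  obtain ⟨F, hF, h⟩ := hA.exists_finite
  exact h.measurableSet hF

theorem inter (hA : IsDecreasing A) (hB : IsDecreasing B) : IsDecreasing (A ∩ B) := by
  obtain ⟨F, hF, h⟩ := hA.exists_finite
  obtain ⟨G, hG, h'⟩ := hB.exists_finite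
  exact ⟨⟨F ∪ G, hF.union hG, h.inter h'⟩, hA.isLowerSet.inter hB.isLowerSet⟩

theorem pr_compl (hA : IsDecreasing A) : pr Aᶜ = 1 - pr A :=
  probReal_compl_eq_one_sub hA.measurableSet

/-- The **Harris inequality**: decreasing events are positively correlated. -/
theorem mul_le_pr_inter (hA : IsDecreasing A) (hB : IsDecreasing B) :
    pr A * pr B ≤ pr (A ∩ B) := by
  classical
  obtain ⟨F, hF, hAF⟩ := hA.exists_finite
  obtain ⟨G, hG, hBG⟩ := hB.exists_finite
  -- The complements are increasing, so their indicators are monotone and `fkg` applies to them with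
  -- constant weight; inclusion–exclusion then transfers the inequality to `A` and `B`.
  have key : pr Aᶜ * pr Bᶜ ≤ pr (Aᶜ ∩ Bᶜ) := by
    obtain ⟨H, hH⟩ := (hF.union hG).exists_finset_coe
    have hA' : DependsOnEdges Aᶜ H := (hAF.mono (by simp [hH])).compl
    have hB' : DependsOnEdges Bᶜ H := (hBG.mono (by simp [hH])).compl
    have hAB' : DependsOnEdges (Aᶜ ∩ Bᶜ) H := by simpa using hA'.inter hB'
    have hmono : ∀ C : Set Config, IsLowerSet C →
        Monotone ((extendClosed H ⁻¹' Cᶜ).indicator (1 : (H → Bool) → ℝ)) := by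
      intro C hC x y hxy
      by_cases hx : x ∈ extendClosed H ⁻¹' Cᶜ
      · have hy : y ∈ extendClosed H ⁻¹' Cᶜ := fun hy => hx (hC (extendClosed_mono H hxy) hy)
        rw [Set.indicator_of_mem hx, Set.indicator_of_mem hy]; rfl
      · rw [Set.indicator_of_notMem hx]
        exact Set.indicator_nonneg (by simp) _
    have hpos : ∀ C : Set Config,
        0 ≤ (extendClosed H ⁻¹' Cᶜ).indicator (1 : (H → Bool) → ℝ) := fun C =>
      Set.indicator_nonneg (by simp)
    have := fkg _ _ (1 : (H → Bool) → ℝ) zero_le_one (hpos A) (hpos B)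
      (hmono A hA.isLowerSet) (hmono B hB.isLowerSet) (by simp)
    simp only [Pi.one_apply, one_mul] at this
    rw [pr_eq_sum hA', pr_eq_sum hB', pr_eq_sum hAB', Set.preimage_inter,
      Set.inter_indicator_one]
    simp only [Pi.mul_apply]
    have hc : (∑ _x : H → Bool, (1 : ℝ)) = 2 ^ H.card := by simp
    rw [hc] at this
    have h2 : ((1 : ℝ) / 2) ^ H.card * 2 ^ H.card = 1 := by
      rw [← mul_pow]; norm_num
    have h3 : (0 : ℝ) ≤ (1 / 2) ^ H.card := by positivity
    have h4 : ∀ r t X Y Z : ℝ, r * t = 1 → 0 ≤ r → X * Y ≤ t * Z → r * X * (r * Y) ≤ r * Z := by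
      intro r t X Y Z h1 h2 h3
      calc r * X * (r * Y) = r * (r * (X * Y)) := by ring
        _ ≤ r * (r * (t * Z)) := by gcongr
        _ = r * (r * t * Z) := by ring
        _ = r * Z := by rw [h1, one_mul]
    exact h4 _ _ _ _ _ h2 h3 this
  have hu : pr (Aᶜ ∩ Bᶜ) = 1 - pr (A ∪ B) := by
    rw [← Set.compl_union]
    exact probReal_compl_eq_one_sub (hA.measurableSet.union hB.measurableSet)
  have hui : pr (A ∪ B) + pr (A ∩ B) = pr A + pr B :=
    measureReal_union_add_inter hB.measurableSet
  rw [hA.pr_compl, hB.pr_compl, hu] at key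
  nlinarith

end IsDecreasing

/-! ### Invariance of the law, and the monotone coupling -/

theorem map_comp_injective (p : I) {f : Edge → Edge} (hf : Function.Injective f) :
    (bernoulliPercolation p).map (fun ω e => ω (f e)) = bernoulliPercolation p :=
  Measure.map_infinitePi_infinitePi_of_inj hf

theorem map_not_half :
    (bernoulliPercolation half).map (fun ω e => !ω e) = bernoulliPercolation half := by
  unfold bernoulliPercolation
  rw [Measure.infinitePi_map_pi (f := fun _ b => !b) _ fun _ => measurable_from_top]
  congr 1
  ext1 e
  refine Measure.ext_of_singleton fun b => ?_
  rw [Measure.map_apply measurable_from_top (MeasurableSet.singleton _)]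
  have : (fun b : Bool => !b) ⁻¹' {b} = {!b} := by ext c; cases b <;> cases c <;> simp
  rw [this, bernoulliMeasure_half_singleton, bernoulliMeasure_half_singleton]

theorem map_threshold (p : I) :
    (volume : Measure I).map (fun t => decide (t ≤ p)) = bernoulliMeasure true false p := by
  have hm : Measurable fun t : I => decide (t ≤ p) := by
    refine measurable_to_bool ?_
    convert! measurableSet_Iic (a := p)
    ext; simp
  have : IsProbabilityMeasure ((volume : Measure I).map (fun t => decide (t ≤ p))) :=
    Measure.isProbabilityMeasure_map hm.aemeasurable
  have h1 : (volume : Measure I).map (fun t => decide (t ≤ p)) {true} =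
      bernoulliMeasure true false p {true} := by
    rw [Measure.map_apply hm (MeasurableSet.singleton _),
      bernoulliMeasure_apply_of_mem_of_notMem _ (MeasurableSet.singleton _) (by simp) (by simp)]
    have : (fun t : I => decide (t ≤ p)) ⁻¹' {true} = Set.Iic p := by ext; simp
    rw [this, unitInterval.volume_Iic]
    exact ENNReal.ofReal_eq_coe_nnreal p.2.1
  refine Measure.ext_of_singleton fun b => ?_
  cases b
  · have hc : ({false} : Set Bool) = {true}ᶜ := by ext b; cases b <;> simp
    rw [hc, prob_compl_eq_one_sub (MeasurableSet.singleton _),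
      prob_compl_eq_one_sub (MeasurableSet.singleton _), h1]
  · exact h1

/-- The probability of an increasing event is increasing in the parameter. -/
theorem bernoulliPercolation_mono {A : Set Config} (hA : IsUpperSet A) (hm : MeasurableSet A)
    {p q : I} (hpq : p ≤ q) : bernoulliPercolation p A ≤ bernoulliPercolation q A := by
  -- One family of independent uniform variables, thresholded at each parameter, couples all the
  -- laws monotonically.
  have key : ∀ p : I, Measurable (fun (t : Edge → I) e => decide (t e ≤ p)) ∧
      bernoulliPercolation p = (Measure.infinitePi fun _ : Edge => (volume : Measure I)).map
        (fun t e => decide (t e ≤ p)) := by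
    intro p
    have hm : Measurable fun t : I => decide (t ≤ p) := by
      refine measurable_to_bool ?_
      convert! measurableSet_Iic (a := p)
      ext; simp
    refine ⟨measurable_pi_lambda _ fun e => hm.comp (measurable_pi_apply e), ?_⟩
    rw [Measure.infinitePi_map_pi (f := fun _ t => decide (t ≤ p)) _ fun _ => hm]
    simp_rw [map_threshold]
    rfl
  rw [(key p).2, (key q).2, Measure.map_apply (key p).1 hm, Measure.map_apply (key q).1 hm]
  refine measure_mono fun t ht => hA (fun e => ?_) ht
  intro h
  simp only [decide_eq_true_eq] at h ⊢
  exact h.trans hpq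

/-! ### Walks confined to a set of vertices -/

section ConnIn

variable {V W : Type*} {G : SimpleGraph V} {G' : SimpleGraph W} {A B : Set V} {u v w : V}

/-- `u` and `v` are joined by a walk of `G` all of whose vertices lie in `A`. -/
def ConnIn (G : SimpleGraph V) (A : Set V) (u v : V) : Prop :=
  ∃ p : G.Walk u v, ∀ w ∈ p.support, w ∈ A

namespace ConnIn

theorem refl (h : u ∈ A) : ConnIn G A u u := ⟨.nil, by simpa using h⟩

theorem symm (h : ConnIn G A u v) : ConnIn G A v u := by
  obtain ⟨p, hp⟩ := h
  exact ⟨p.reverse, by simpa using hp⟩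

theorem trans (h : ConnIn G A u v) (h' : ConnIn G A v w) : ConnIn G A u w := by
  obtain ⟨p, hp⟩ := h
  obtain ⟨q, hq⟩ := h'
  refine ⟨p.append q, fun z hz => ?_⟩
  rw [SimpleGraph.Walk.mem_support_append_iff] at hz
  exact hz.elim (hp z) (hq z)

theorem left_mem (h : ConnIn G A u v) : u ∈ A := by
  obtain ⟨p, hp⟩ := h
  exact hp _ p.start_mem_support

theorem right_mem (h : ConnIn G A u v) : v ∈ A := h.symm.left_mem

theorem of_adj (hu : u ∈ A) (hv : v ∈ A) (h : G.Adj u v) : ConnIn G A u v := by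
  refine ⟨.cons h .nil, fun z hz => ?_⟩
  simp only [SimpleGraph.Walk.support_cons, SimpleGraph.Walk.support_nil, List.mem_cons,
    List.not_mem_nil, or_false] at hz
  rcases hz with rfl | rfl <;> assumption

theorem tail (h : ConnIn G A u v) (hw : w ∈ A) (h' : G.Adj v w) : ConnIn G A u w :=
  h.trans (of_adj h.right_mem hw h')

theorem induction (h : ConnIn G A u v) {P : V → Prop} (h0 : P u)
    (hs : ∀ x y, P x → x ∈ A → y ∈ A → G.Adj x y → P y) : P v := by
  obtain ⟨p, hp⟩ := h
  induction p with
  | nil => exact h0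
  | cons hadj q ih =>
    simp only [SimpleGraph.Walk.support_cons, List.mem_cons, forall_eq_or_imp] at hp
    exact ih (hs _ _ h0 hp.1 (hp.2 _ q.start_mem_support) hadj) hp.2

theorem map (h : ConnIn G A u v) {B : Set W} (f : V → W) (hf : ∀ z ∈ A, f z ∈ B)
    (hadj : ∀ x ∈ A, ∀ y ∈ A, G.Adj x y → G'.Adj (f x) (f y)) : ConnIn G' B (f u) (f v) :=
  h.induction (P := fun z => ConnIn G' B (f u) (f z)) (.refl (hf _ h.left_mem))
    fun x y hx hxA hyA hxy => hx.tail (hf _ hyA) (hadj x hxA y hyA hxy)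

theorem mono (h : ConnIn G A u v) (hAB : A ⊆ B) : ConnIn G B u v :=
  h.map id hAB fun _ _ _ _ h => h

theorem cluster (h : ConnIn G A u v) : ConnIn G {z | ConnIn G A u z} u v :=
  h.induction (P := fun z => ConnIn G {z | ConnIn G A u z} u z) (.refl (.refl h.left_mem))
    fun _ _ hx _ hyA hxy => hx.tail (hx.right_mem.tail hyA hxy) hxy

theorem of_reachable (h : G.Reachable u v) : ConnIn G Set.univ u v := by
  obtain ⟨p⟩ := h
  exact ⟨p, fun _ _ => trivial⟩

theorem reachable (h : ConnIn G A u v) : G.Reachable u v := h.elim fun p _ => ⟨p⟩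

/-- A path in `A` that starts in `B` either stays in `B` or has a first exit. -/
theorem exit (h : ConnIn G A u v) (hu : u ∈ B) :
    (ConnIn G (A ∩ B) u v) ∨
      ∃ w w', ConnIn G (A ∩ B) u w ∧ G.Adj w w' ∧ w' ∈ A ∧ w' ∉ B := by
  refine h.induction (P := fun z => ConnIn G (A ∩ B) u z ∨
      ∃ w w', ConnIn G (A ∩ B) u w ∧ G.Adj w w' ∧ w' ∈ A ∧ w' ∉ B)
    (Or.inl (.refl ⟨h.left_mem, hu⟩)) fun x y hx _ hyA hxy => ?_
  rcases hx with hx | hx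
  · by_cases hy : y ∈ B
    · exact Or.inl (hx.tail ⟨hyA, hy⟩ hxy)
    · exact Or.inr ⟨x, y, hx, hxy, hyA, hy⟩
  · exact Or.inr hx

/-- First hitting of a level of a function that changes by at most one along edges. -/
theorem firstHit (h : ConnIn G A u v) (f : V → ℤ) (hf : ∀ x y, G.Adj x y → |f x - f y| ≤ 1)
    {a : ℤ} (hu : a ≤ f u) (hv : f v ≤ a) :
    ∃ s, f s = a ∧ ConnIn G (A ∩ {z | a ≤ f z}) u s := by
  rcases h.exit (B := {z | a ≤ f z}) hu with h' | ⟨w, w', h1, h2, -, h4⟩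
  · exact ⟨v, le_antisymm hv h'.right_mem.2, h'⟩
  · refine ⟨w, ?_, h1⟩
    have h5 := hf _ _ h2
    have h6 : a ≤ f w := h1.right_mem.2
    simp only [Set.mem_ofPred_eq, not_le] at h4
    rw [abs_le] at h5
    omega

/-- A path that passes from level `≤ a` to level `≥ b` contains a crossing of the strip. -/
theorem strip (h : ConnIn G A u v) (f : V → ℤ) (hf : ∀ x y, G.Adj x y → |f x - f y| ≤ 1)
    {a b : ℤ} (hab : a ≤ b) (hu : f u ≤ a) (hv : b ≤ f v) :
    ∃ s t, f s = a ∧ f t = b ∧ ConnIn G (A ∩ {z | a ≤ f z ∧ f z ≤ b}) s t := by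
  obtain ⟨s, hs, h1⟩ := h.symm.firstHit f hf (hab.trans hv) hu
  obtain ⟨t, ht, h2⟩ := h1.symm.firstHit (fun z => -f z)
    (fun x y hxy => by
      have := hf x y hxy
      rw [abs_le] at this ⊢
      constructor <;> linarith [this.1, this.2]) (a := -b) (by simp [hs, hab]) (by simpa using hv)
  refine ⟨s, t, hs, by simpa using ht, h2.mono ?_⟩
  rintro z ⟨⟨h3, h4⟩, h5⟩
  exact ⟨h3, h4, by simpa using h5⟩

end ConnIn

end ConnIn

/-! ### Open paths in the lattice and crossing events -/

theorem squareLattice_adj_iff {x y : ℤ × ℤ} : squareLattice.Adj x y ↔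
    (y = (x.1 + 1, x.2) ∨ x = (y.1 + 1, y.2)) ∨ (y = (x.1, x.2 + 1) ∨ x = (y.1, y.2 + 1)) := by
  obtain ⟨a, b⟩ := x
  obtain ⟨c, d⟩ := y
  simp only [squareLattice, Prod.mk.injEq]
  constructor
  · intro h
    have h1 : a - c ≤ 1 := by nlinarith [sq_nonneg (b - d)]
    have h2 : -1 ≤ a - c := by nlinarith [sq_nonneg (b - d)]
    have h3 : b - d ≤ 1 := by nlinarith [sq_nonneg (a - c)]
    have h4 : -1 ≤ b - d := by nlinarith [sq_nonneg (a - c)]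
    obtain h5 | h5 | h5 : a - c = -1 ∨ a - c = 0 ∨ a - c = 1 := by omega
    all_goals
      obtain h6 | h6 | h6 : b - d = -1 ∨ b - d = 0 ∨ b - d = 1 := by omega
      all_goals rw [h5, h6] at h
      all_goals omega
  · rintro ((⟨rfl, rfl⟩ | ⟨rfl, rfl⟩) | (⟨rfl, rfl⟩ | ⟨rfl, rfl⟩)) <;> ring

theorem squareLattice_adj_fst {x y : ℤ × ℤ} (h : squareLattice.Adj x y) : |x.1 - y.1| ≤ 1 := by
  rw [squareLattice_adj_iff] at h
  rw [abs_le]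
  rcases h with (h | h) | (h | h) <;> rw [h] <;> constructor <;> simp

theorem squareLattice_adj_snd {x y : ℤ × ℤ} (h : squareLattice.Adj x y) : |x.2 - y.2| ≤ 1 := by
  rw [squareLattice_adj_iff] at h
  rw [abs_le]
  rcases h with (h | h) | (h | h) <;> rw [h] <;> constructor <;> simp

theorem openGraph_adj {ω : Config} {x y : ℤ × ℤ} :
    (openGraph ω).Adj x y ↔ ∃ h : squareLattice.Adj x y, ω ⟨s(x, y), h⟩ = true := by
  simp only [openGraph, SimpleGraph.fromEdgeSet_adj, Set.mem_ofPred_eq]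
  exact ⟨fun h => h.1, fun h => ⟨h, h.1.ne⟩⟩

theorem openGraph_le (ω : Config) {x y : ℤ × ℤ} (h : (openGraph ω).Adj x y) :
    squareLattice.Adj x y := (openGraph_adj.1 h).1

theorem openGraph_adj_mono {ω ω' : Config} (hω : ω ≤ ω') {x y : ℤ × ℤ}
    (h : (openGraph ω).Adj x y) : (openGraph ω').Adj x y := by
  rw [openGraph_adj] at h ⊢
  obtain ⟨h1, h2⟩ := h
  exact ⟨h1, hω _ h2⟩

theorem openGraph_adj_fst {ω : Config} (x y : ℤ × ℤ) (h : (openGraph ω).Adj x y) :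
    |x.1 - y.1| ≤ 1 := squareLattice_adj_fst (openGraph_le ω h)

theorem openGraph_adj_snd {ω : Config} (x y : ℤ × ℤ) (h : (openGraph ω).Adj x y) :
    |x.2 - y.2| ≤ 1 := squareLattice_adj_snd (openGraph_le ω h)

/-- The edges with both endpoints in `A`. -/
def edgesIn (A : Set (ℤ × ℤ)) : Set Edge := {e | ∀ z ∈ e.1, z ∈ A}

theorem edgesIn_mono {A B : Set (ℤ × ℤ)} (h : A ⊆ B) : edgesIn A ⊆ edgesIn B :=
  fun _ he z hz => h (he z hz)

theorem disjoint_edgesIn {A B : Set (ℤ × ℤ)} (h : Disjoint A B) :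
    Disjoint (edgesIn A) (edgesIn B) := by
  rw [Set.disjoint_left]
  rintro ⟨e, he⟩ h1 h2
  induction e with
  | _ x y => exact Set.disjoint_left.1 h (h1 x (Sym2.mem_mk_left x y)) (h2 x (Sym2.mem_mk_left x y))

theorem edgesIn_finite {A : Set (ℤ × ℤ)} (hA : A.Finite) : (edgesIn A).Finite := by
  refine Set.Finite.of_finite_image (f := Subtype.val) (((hA.prod hA).image
    fun p => s(p.1, p.2)).subset ?_) Subtype.val_injective.injOn
  rintro _ ⟨⟨e, he⟩, h, rfl⟩
  induction e with
  | _ x y => exact ⟨(x, y), ⟨h x (Sym2.mem_mk_left x y), h y (Sym2.mem_mk_right x y)⟩, rfl⟩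

theorem openGraph_adj_congr {A : Set (ℤ × ℤ)} {ω ω' : Config}
    (h : ∀ e ∈ edgesIn A, ω e = ω' e) {x y : ℤ × ℤ} (hx : x ∈ A) (hy : y ∈ A)
    (hxy : (openGraph ω).Adj x y) : (openGraph ω').Adj x y := by
  rw [openGraph_adj] at hxy ⊢
  obtain ⟨h1, h2⟩ := hxy
  refine ⟨h1, ?_⟩
  rw [← h, h2]
  intro z hz
  rcases Sym2.mem_iff.1 hz with rfl | rfl <;> assumption

theorem ConnIn.congr_config {A : Set (ℤ × ℤ)} {ω ω' : Config}
    (h : ∀ e ∈ edgesIn A, ω e = ω' e) {u v : ℤ × ℤ} (huv : ConnIn (openGraph ω) A u v) :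
    ConnIn (openGraph ω') A u v :=
  huv.map id (fun _ hz => hz) fun _ hx _ hy hxy => openGraph_adj_congr h hx hy hxy

theorem ConnIn.mono_config {A : Set (ℤ × ℤ)} {ω ω' : Config} (h : ω ≤ ω') {u v : ℤ × ℤ}
    (huv : ConnIn (openGraph ω) A u v) : ConnIn (openGraph ω') A u v :=
  huv.map id (fun _ hz => hz) fun _ _ _ _ hxy => openGraph_adj_mono h hxy

theorem ConnIn.lattice {A : Set (ℤ × ℤ)} {ω : Config} {u v : ℤ × ℤ}
    (huv : ConnIn (openGraph ω) A u v) : ConnIn squareLattice A u v :=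
  huv.map id (fun _ hz => hz) fun _ _ _ _ hxy => openGraph_le ω hxy

/-- The event that some pair of vertices related by `Q` is joined by an open path in `A`. -/
def connEvent (A : Set (ℤ × ℤ)) (Q : ℤ × ℤ → ℤ × ℤ → Prop) : Set Config :=
  {ω | ∃ u v, Q u v ∧ ConnIn (openGraph ω) A u v}

theorem dependsOnEdges_connEvent (A : Set (ℤ × ℤ)) (Q : ℤ × ℤ → ℤ × ℤ → Prop) :
    DependsOnEdges (connEvent A Q) (edgesIn A) := by
  rintro ω ω' h ⟨u, v, hQ, huv⟩
  exact ⟨u, v, hQ, huv.congr_config h⟩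

theorem isUpperSet_connEvent (A : Set (ℤ × ℤ)) (Q : ℤ × ℤ → ℤ × ℤ → Prop) :
    IsUpperSet (connEvent A Q) := by
  rintro ω ω' h ⟨u, v, hQ, huv⟩
  exact ⟨u, v, hQ, huv.mono_config h⟩

theorem measurableSet_connEvent {A : Set (ℤ × ℤ)} (hA : A.Finite) (Q : ℤ × ℤ → ℤ × ℤ → Prop) :
    MeasurableSet (connEvent A Q) :=
  (dependsOnEdges_connEvent A Q).measurableSet (edgesIn_finite hA)

theorem isDecreasing_compl_connEvent {A : Set (ℤ × ℤ)} (hA : A.Finite)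
    (Q : ℤ × ℤ → ℤ × ℤ → Prop) : IsDecreasing (connEvent A Q)ᶜ :=
  ⟨⟨_, edgesIn_finite hA, (dependsOnEdges_connEvent A Q).compl⟩,
    (isUpperSet_connEvent A Q).compl⟩

/-- The lattice rectangle `[a, b] × [c, d]`. -/
def rect (a b c d : ℤ) : Set (ℤ × ℤ) := {z | (a ≤ z.1 ∧ z.1 ≤ b) ∧ c ≤ z.2 ∧ z.2 ≤ d}

theorem rect_finite (a b c d : ℤ) : (rect a b c d).Finite := by
  refine ((Set.finite_Icc a b).prod (Set.finite_Icc c d)).subset ?_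
  rintro z ⟨h1, h2⟩
  exact ⟨h1, h2⟩

/-- There is an open path in `[a, b] × [c, d]` from the left side to the right side. -/
def hcross (a b c d : ℤ) : Set Config :=
  connEvent (rect a b c d) fun u v => u.1 = a ∧ v.1 = b

/-- There is an open path in `[a, b] × [c, d]` from the bottom to the top. -/
def vcross (a b c d : ℤ) : Set Config :=
  connEvent (rect a b c d) fun u v => u.2 = c ∧ v.2 = d

theorem isDecreasing_compl_hcross (a b c d : ℤ) : IsDecreasing (hcross a b c d)ᶜ :=
  isDecreasing_compl_connEvent (rect_finite _ _ _ _) _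

theorem isDecreasing_compl_vcross (a b c d : ℤ) : IsDecreasing (vcross a b c d)ᶜ :=
  isDecreasing_compl_connEvent (rect_finite _ _ _ _) _

theorem mem_hcross_of_connIn {ω : Config} {A : Set (ℤ × ℤ)} {u v : ℤ × ℤ} {a b c d : ℤ}
    (h : ConnIn (openGraph ω) A u v) (hA : ∀ z ∈ A, c ≤ z.2 ∧ z.2 ≤ d) (hab : a ≤ b)
    (hu : u.1 ≤ a) (hv : b ≤ v.1) : ω ∈ hcross a b c d := by
  obtain ⟨s, t, hs, ht, h⟩ := h.strip Prod.fst openGraph_adj_fst hab hu hv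
  exact ⟨s, t, ⟨hs, ht⟩, h.mono fun z hz => ⟨hz.2, hA z hz.1⟩⟩

theorem mem_vcross_of_connIn {ω : Config} {A : Set (ℤ × ℤ)} {u v : ℤ × ℤ} {a b c d : ℤ}
    (h : ConnIn (openGraph ω) A u v) (hA : ∀ z ∈ A, a ≤ z.1 ∧ z.1 ≤ b) (hcd : c ≤ d)
    (hu : u.2 ≤ c) (hv : d ≤ v.2) : ω ∈ vcross a b c d := by
  obtain ⟨s, t, hs, ht, h⟩ := h.strip Prod.snd openGraph_adj_snd hcd hu hv
  exact ⟨s, t, ⟨hs, ht⟩, h.mono fun z hz => ⟨hA z hz.1, hz.2⟩⟩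

/-! ### Lattice symmetries -/

/-- The action of a lattice automorphism on configurations. -/
def pull (f : squareLattice ≃g squareLattice) (ω : Config) : Config := fun e => ω (f.mapEdgeSet e)

theorem openGraph_pull_adj (f : squareLattice ≃g squareLattice) (ω : Config) (x y : ℤ × ℤ) :
    (openGraph (pull f ω)).Adj x y ↔ (openGraph ω).Adj (f x) (f y) := by
  rw [openGraph_adj, openGraph_adj]
  exact ⟨fun ⟨h, h'⟩ => ⟨f.map_adj_iff.2 h, h'⟩, fun ⟨h, h'⟩ => ⟨f.map_adj_iff.1 h, h'⟩⟩

theorem connIn_pull_iff (f : squareLattice ≃g squareLattice) (ω : Config) (A : Set (ℤ × ℤ))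
    (u v : ℤ × ℤ) : ConnIn (openGraph (pull f ω)) (f ⁻¹' A) u v ↔
      ConnIn (openGraph ω) A (f u) (f v) := by
  refine ⟨fun h => h.map f (fun z hz => hz) fun x _ y _ hxy => (openGraph_pull_adj f ω x y).1 hxy,
    fun h => ?_⟩
  have := h.map (G' := openGraph (pull f ω)) (B := f ⁻¹' A) f.symm (by simp) fun x _ y _ hxy => by
    rw [openGraph_pull_adj]; simpa using hxy
  simpa using this

theorem measure_pull_preimage (p : I) (f : squareLattice ≃g squareLattice) {A : Set Config}
    (hA : MeasurableSet A) :
    bernoulliPercolation p (pull f ⁻¹' A) = bernoulliPercolation p A := by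
  have h := map_comp_injective p (f := f.mapEdgeSet) f.mapEdgeSet.injective
  conv_rhs => rw [← h]
  rw [Measure.map_apply (measurable_pi_lambda _ fun e => measurable_pi_apply _) hA]
  rfl

theorem pr_pull_preimage (f : squareLattice ≃g squareLattice) {A : Set Config}
    (hA : MeasurableSet A) : pr (pull f ⁻¹' A) = pr A := by
  rw [pr, pr, measureReal_def, measure_pull_preimage _ f hA, measureReal_def]

theorem pull_preimage_connEvent (f : squareLattice ≃g squareLattice) {A B : Set (ℤ × ℤ)}
    {Q Q' : ℤ × ℤ → ℤ × ℤ → Prop} (hA : f ⁻¹' B = A) (hQ : ∀ u v, Q u v ↔ Q' (f u) (f v)) :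
    pull f ⁻¹' connEvent A Q = connEvent B Q' := by
  subst hA
  ext ω
  constructor
  · rintro ⟨u, v, h, h'⟩
    exact ⟨f u, f v, (hQ u v).1 h, (connIn_pull_iff f ω B u v).1 h'⟩
  · rintro ⟨u, v, h, h'⟩
    refine ⟨f.symm u, f.symm v, (hQ _ _).2 (by simpa using h), ?_⟩
    rw [connIn_pull_iff]
    simpa using h'

/-- Translation of the square lattice. -/
def shift (a : ℤ × ℤ) : squareLattice ≃g squareLattice where
  toEquiv := Equiv.addRight a
  map_rel_iff' := by intro x y; simp [squareLattice]

/-- The reflection `x ↦ c - x` of the first coordinate. -/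
def reflectX (c : ℤ) : squareLattice ≃g squareLattice where
  toFun z := (c - z.1, z.2)
  invFun z := (c - z.1, z.2)
  left_inv z := by simp
  right_inv z := by simp
  map_rel_iff' := by intro x y; simp [squareLattice, sub_sq_comm y.1]

/-- The reflection `y ↦ c - y` of the second coordinate. -/
def reflectY (c : ℤ) : squareLattice ≃g squareLattice where
  toFun z := (z.1, c - z.2)
  invFun z := (z.1, c - z.2)
  left_inv z := by simp
  right_inv z := by simp
  map_rel_iff' := by intro x y; simp [squareLattice, sub_sq_comm y.2]

/-- The reflection of the square lattice in the diagonal. -/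
def diagonal : squareLattice ≃g squareLattice where
  toEquiv := Equiv.prodComm ℤ ℤ
  map_rel_iff' := by intro x y; simp [squareLattice, add_comm]

@[simp] theorem shift_apply (a z : ℤ × ℤ) : shift a z = z + a := rfl
@[simp] theorem reflectX_apply (c : ℤ) (z : ℤ × ℤ) : reflectX c z = (c - z.1, z.2) := rfl
@[simp] theorem reflectY_apply (c : ℤ) (z : ℤ × ℤ) : reflectY c z = (z.1, c - z.2) := rfl
@[simp] theorem diagonal_apply (z : ℤ × ℤ) : diagonal z = (z.2, z.1) := rfl

/-! ### Probabilities of absent crossings -/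

/-- The probability that the rectangle `[0, w] × [0, h]` is not crossed from bottom to top. -/
noncomputable def nv (w h : ℤ) : ℝ := pr (vcross 0 w 0 h)ᶜ

theorem pr_compl_vcross (a b c d : ℤ) : pr (vcross a b c d)ᶜ = nv (b - a) (d - c) := by
  have : pull (shift (a, c)) ⁻¹' (vcross 0 (b - a) 0 (d - c)) = vcross a b c d := by
    refine pull_preimage_connEvent _ ?_ fun u v => ?_
    · ext z; simp [rect, le_sub_iff_add_le]
    · simp [← eq_sub_iff_add_eq]
  rw [nv, ← this, ← Set.preimage_compl,
    pr_pull_preimage _ (isDecreasing_compl_vcross _ _ _ _).measurableSet]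

theorem pr_compl_hcross (a b c d : ℤ) : pr (hcross a b c d)ᶜ = nv (d - c) (b - a) := by
  have : pull diagonal ⁻¹' (vcross c d a b) = hcross a b c d := by
    refine pull_preimage_connEvent _ ?_ fun u v => ?_
    · ext z; simp [rect, and_comm]
    · simp
  rw [← pr_compl_vcross, ← this, ← Set.preimage_compl,
    pr_pull_preimage _ (isDecreasing_compl_vcross _ _ _ _).measurableSet]

theorem nv_mono {w w' h h' : ℤ} (hw : w' ≤ w) (hh : h ≤ h') (h0 : 0 ≤ h) : nv w h ≤ nv w' h' := by
  refine pr_mono (Set.compl_subset_compl.2 ?_)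
  rintro ω ⟨u, v, ⟨hu, hv⟩, huv⟩
  refine mem_vcross_of_connIn huv (fun z hz => ⟨hz.1.1, hz.1.2.trans hw⟩) h0 hu.le ?_
  rw [hv]; exact hh

/-- Gluing of two overlapping rectangles that are not crossed from bottom to top. -/
theorem nv_glue {w₁ w₂ o h : ℤ} (ho : 0 ≤ o) (hh : 0 ≤ h) :
    nv w₁ h * nv w₂ h * nv h o ≤ nv (w₁ + w₂ - o) h := by
  have e1 : nv w₁ h = pr (vcross 0 w₁ 0 h)ᶜ := rfl
  have e2 : nv w₂ h = pr (vcross (w₁ - o) (w₁ + w₂ - o) 0 h)ᶜ := by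
    rw [pr_compl_vcross]; congr 1 <;> ring
  have e3 : nv h o = pr (hcross (w₁ - o) w₁ 0 h)ᶜ := by
    rw [pr_compl_hcross]; congr 1 <;> ring
  have d1 := isDecreasing_compl_vcross 0 w₁ 0 h
  have d2 := isDecreasing_compl_vcross (w₁ - o) (w₁ + w₂ - o) 0 h
  have d3 := isDecreasing_compl_hcross (w₁ - o) w₁ 0 h
  rw [e1, e2, e3]
  refine (mul_le_mul_of_nonneg_right (d1.mul_le_pr_inter d2) (pr_nonneg _)).trans
    (((d1.inter d2).mul_le_pr_inter d3).trans (pr_mono ?_))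
  rintro ω ⟨⟨n1, n2⟩, n3⟩ ⟨u, v, ⟨hu, hv⟩, huv⟩
  -- A vertical crossing of the union cannot stay in either rectangle, so it reaches both vertical
  -- sides of the overlap and hence crosses the overlap horizontally.
  have s1 : ∃ z, w₁ ≤ z.1 ∧ ConnIn (openGraph ω) (rect 0 (w₁ + w₂ - o) 0 h) u z := by
    by_cases hu1 : u.1 ≤ w₁
    · rcases huv.exit (B := {z : ℤ × ℤ | z.1 ≤ w₁}) hu1 with h' | ⟨w, w', c1, c2, c3, c4⟩
      · exact absurd (mem_vcross_of_connIn h' (fun z hz => ⟨hz.1.1.1, hz.2⟩) hh hu.le hv.ge) n1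
      · exact ⟨w', (not_le.1 c4).le, (c1.mono Set.inter_subset_left).tail c3 c2⟩
    · exact ⟨u, (not_le.1 hu1).le, .refl huv.left_mem⟩
  have s2 : ∃ z, z.1 ≤ w₁ - o ∧ ConnIn (openGraph ω) (rect 0 (w₁ + w₂ - o) 0 h) u z := by
    by_cases hu1 : w₁ - o ≤ u.1
    · rcases huv.exit (B := {z : ℤ × ℤ | w₁ - o ≤ z.1}) hu1 with h' | ⟨w, w', c1, c2, c3, c4⟩
      · exact absurd (mem_vcross_of_connIn h' (fun z hz => ⟨hz.2, hz.1.1.2⟩) hh hu.le hv.ge) n2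
      · exact ⟨w', (not_le.1 c4).le, (c1.mono Set.inter_subset_left).tail c3 c2⟩
    · exact ⟨u, (not_le.1 hu1).le, .refl huv.left_mem⟩
  obtain ⟨z, hz, hz'⟩ := s1
  obtain ⟨y, hy, hy'⟩ := s2
  exact n3 (mem_hcross_of_connIn (hy'.symm.trans hz') (fun z hz => hz.2) (by omega) hy hz)

/-! ### Planar topology by parity counts -/

/-- The indicator of a proposition, modulo `2`. -/
noncomputable def ind (P : Prop) : ZMod 2 := by classical exact if P then 1 else 0

theorem ind_pos {P : Prop} (h : P) : ind P = 1 := by simp [ind, h]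

theorem ind_neg {P : Prop} (h : ¬P) : ind P = 0 := by simp [ind, h]

theorem zmod_two_add_self (a : ZMod 2) : a + a = 0 := CharTwo.add_self_eq_zero a

/-- The face with lower left corner `z` lies below the horizontal edge `uv`, modulo `2`. -/
noncomputable def stepAbove (u v z : ℤ × ℤ) : ZMod 2 :=
  ind (u.2 = v.2 ∧ z.2 < u.2 ∧ ((u.1 = z.1 ∧ v.1 = z.1 + 1) ∨ (v.1 = z.1 ∧ u.1 = z.1 + 1)))

/-- The number, modulo `2`, of steps of a walk that cross the upward vertical ray from the centre
of the face with lower left corner `z`. -/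
noncomputable def above {u v : ℤ × ℤ} (p : squareLattice.Walk u v) (z : ℤ × ℤ) : ZMod 2 :=
  match p with
  | .nil => 0
  | .cons (u := a) (v := b) _ q => stepAbove a b z + above q z

section above

variable {a b : ℤ × ℤ} (p : squareLattice.Walk a b) {x y : ℤ}

/-- The upward rays from these two vertically adjacent faces differ exactly by the edge that
separates the faces. -/
theorem above_eq_of_horizontal (h : s((x, y), (x + 1, y)) ∉ p.edges) :
    above p (x, y - 1) = above p (x, y) := by
  induction p with
  | nil => rfl
  | @cons u v w hadj q ih =>
    simp only [SimpleGraph.Walk.edges_cons, List.mem_cons, not_or] at h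
    rw [above, above, ih h.2]
    congr 1
    have h1 := h.1
    rw [Sym2.eq_iff, Prod.ext_iff, Prod.ext_iff, Prod.ext_iff, Prod.ext_iff] at h1
    simp only at h1
    unfold stepAbove
    congr 1
    simp only [eq_iff_iff]
    constructor
    · rintro ⟨h2, h3, h4⟩
      refine ⟨h2, ?_, h4⟩
      by_contra h5
      apply h1
      omega
    · rintro ⟨h2, h3, h4⟩
      refine ⟨h2, ?_, h4⟩
      omega

/-- The left-hand side counts the passages of the walk into or out of the half-line above height `y`
in column `x`: since the edge at its foot is unused, they are all horizontal steps. Their parity is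
decided by which ends of the walk lie on the half-line. -/
theorem above_add_of_vertical (h : s((x, y), (x, y + 1)) ∉ p.edges) :
    above p (x - 1, y) + above p (x, y) = ind (a.1 = x ∧ y < a.2) + ind (b.1 = x ∧ y < b.2) := by
  induction p with
  | nil => simp [above, zmod_two_add_self]
  | @cons u v w hadj q ih =>
    simp only [SimpleGraph.Walk.edges_cons, List.mem_cons, not_or] at h
    have h1 := h.1
    rw [Sym2.eq_iff] at h1
    have key : stepAbove u v (x - 1, y) + stepAbove u v (x, y) =
        ind (u.1 = x ∧ y < u.2) + ind (v.1 = x ∧ y < v.2) := by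
      obtain ⟨u1, u2⟩ := u
      obtain ⟨v1, v2⟩ := v
      simp only [Prod.mk.injEq] at h1
      rw [squareLattice_adj_iff] at hadj
      simp only [Prod.mk.injEq] at hadj
      unfold stepAbove ind
      simp only
      split_ifs <;> first | rfl | (exfalso; omega)
    rw [above, above]
    linear_combination key + ih h.2 + zmod_two_add_self (ind (v.1 = x ∧ y < v.2))

theorem above_eq_zero_of_le (h : ∀ w ∈ p.support, w.2 ≤ y) : above p (x, y) = 0 := by
  induction p with
  | nil => rfl
  | @cons u v w hadj q ih =>
    simp only [SimpleGraph.Walk.support_cons, List.mem_cons, forall_eq_or_imp] at h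
    rw [above, ih h.2, stepAbove, ind_neg, add_zero]
    simp only
    omega

theorem above_eq_zero_of_lt_fst (h : ∀ w ∈ p.support, x < w.1) : above p (x, y) = 0 := by
  induction p with
  | nil => rfl
  | @cons u v w hadj q ih =>
    simp only [SimpleGraph.Walk.support_cons, List.mem_cons, forall_eq_or_imp] at h
    have := h.2 _ q.start_mem_support
    rw [above, ih h.2, stepAbove, ind_neg, add_zero]
    simp only
    omega

/-- From below the walk, the ray meets every step across the vertical line at abscissa `x + 1/2`, so
the parity records whether the ends are on different sides of it. -/
theorem above_of_lt (h : ∀ w ∈ p.support, y < w.2) :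
    above p (x, y) = ind (a.1 ≤ x) + ind (b.1 ≤ x) := by
  induction p with
  | nil => simp [above, zmod_two_add_self]
  | @cons u v w hadj q ih =>
    simp only [SimpleGraph.Walk.support_cons, List.mem_cons, forall_eq_or_imp] at h
    have h2 := h.2 _ q.start_mem_support
    have key : stepAbove u v (x, y) = ind (u.1 ≤ x) + ind (v.1 ≤ x) := by
      have h1 := h.1
      obtain ⟨u1, u2⟩ := u
      obtain ⟨v1, v2⟩ := v
      rw [squareLattice_adj_iff] at hadj
      simp only [Prod.mk.injEq] at hadj h1 h2
      unfold stepAbove ind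
      simp only
      split_ifs <;> first | rfl | (exfalso; omega)
    rw [above]
    linear_combination key + ih h.2 + zmod_two_add_self (ind (v.1 ≤ x))

end above

/-- Paths in `{x ≥ 0, 0 ≤ y ≤ H}` from the left side to the top and from the bottom to a higher
point of the left side intersect. -/
theorem inter_nonempty_of_connIn {A B : Set (ℤ × ℤ)} {y₀ y₁ s t H : ℤ}
    (hA : ConnIn squareLattice A (0, y₀) (t, H)) (hB : ConnIn squareLattice B (s, 0) (0, y₁))
    (hA' : ∀ z ∈ A, 0 ≤ z.1 ∧ 0 ≤ z.2 ∧ z.2 ≤ H) (hB' : ∀ z ∈ B, 0 ≤ z.1 ∧ 0 ≤ z.2 ∧ z.2 ≤ H)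
    (hy : y₀ < y₁) : ∃ z ∈ A, z ∈ B := by
  by_contra! hdisj
  obtain ⟨p, hp⟩ := hA
  have ht := hA' _ (hp _ p.end_mem_support)
  have hy0 := hA' _ (hp _ p.start_mem_support)
  have hs := hB' _ hB.left_mem
  have hy1 := hB' _ hB.right_mem
  simp only at ht hy0 hs hy1
  have e1 : squareLattice.Adj (-1, y₀) (0, y₀) := by rw [squareLattice_adj_iff]; simp
  have e2 : squareLattice.Adj (t, H) (t, H + 1) := by rw [squareLattice_adj_iff]; simp
  let r : squareLattice.Walk (0, y₀) (t, H + 1) := p.concat e2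
  have hr : ∀ z ∈ r.support, z ∈ A ∨ z = (t, H + 1) := by
    intro z hz
    rw [SimpleGraph.Walk.support_concat, List.mem_append] at hz
    exact hz.imp (hp z) (by simp)
  -- One extra step at each end pushes the endpoints out of the region, so the parity changes along
  -- `B` come only from the upper end.
  let q : squareLattice.Walk (-1, y₀) (t, H + 1) := .cons e1 r
  have hq : ∀ z ∈ q.support, z ∈ A ∨ z = (t, H + 1) ∨ z = (-1, y₀) := by
    intro z hz
    rw [SimpleGraph.Walk.support_cons, List.mem_cons] at hz
    rcases hz with h | h
    · exact Or.inr (Or.inr h)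
    · rcases hr z h with h | h
      · exact Or.inl h
      · exact Or.inr (Or.inl h)
  have hqB : ∀ z ∈ B, z ∉ q.support := by
    intro z hz hz'
    have h1 := hB' z hz
    rcases hq z hz' with h | h | h
    · exact hdisj z h hz
    · rw [h] at h1; simp only at h1; omega
    · rw [h] at h1; simp only at h1; omega
  have hedge : ∀ z ∈ B, ∀ w, s(z, w) ∉ q.edges := fun z hz w hw =>
    hqB z hz (q.fst_mem_support_of_mem_edges hw)
  -- The vertices of `B` are read as faces, by lower left corner. The edges separating consecutive
  -- faces then have an endpoint in `B`, hence are not used by `q`. The term `ind (t ≤ z.1)`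
  -- compensates the jump caused by the end of `q` in column `t`.
  have hinv : ∀ z : ℤ × ℤ, ConnIn squareLattice B (s, 0) z →
      above q z + ind (t ≤ z.1) = above q (s, 0) + ind (t ≤ s) := by
    intro z hz
    refine hz.induction (P := fun z => above q z + ind (t ≤ z.1) = above q (s, 0) + ind (t ≤ s))
      rfl fun z w ih hzB hwB hzw => ?_
    rw [← ih]
    have vert : ∀ x y : ℤ, (x, y) ∈ B → above q (x, y - 1) = above q (x, y) := fun x y h =>
      above_eq_of_horizontal q (hedge _ h _)
    have hor : ∀ x y : ℤ, (x, y) ∈ B → (x - 1, y) ∈ B →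
        above q (x - 1, y) + ind (t ≤ x - 1) = above q (x, y) + ind (t ≤ x) := by
      intro x y h h'
      have h1 := above_add_of_vertical q (hedge _ h (x, y + 1))
      have h2 := hB' _ h
      have h2' := hB' _ h'
      simp only at h2 h2'
      rw [ind_neg (P := (-1 : ℤ) = x ∧ y < y₀) (by omega)] at h1
      have h3 : ind (t = x ∧ y < H + 1) + ind (t ≤ x - 1) = ind (t ≤ x) := by
        unfold ind
        split_ifs <;> first | rfl | (exfalso; omega)
      simp only at h1
      linear_combination h1 + h3 - zmod_two_add_self (above q (x, y))
        + zmod_two_add_self (ind (t ≤ x - 1)) - zmod_two_add_self (ind (t ≤ x - 1))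
    obtain ⟨z1, z2⟩ := z
    obtain ⟨w1, w2⟩ := w
    rw [squareLattice_adj_iff] at hzw
    simp only [Prod.mk.injEq] at hzw
    rcases hzw with (⟨rfl, rfl⟩ | ⟨rfl, rfl⟩) | (⟨rfl, rfl⟩ | ⟨rfl, rfl⟩)
    · have := hor _ _ hwB (by simpa using hzB)
      simpa using this.symm
    · have := hor _ _ hzB (by simpa using hwB)
      simpa using this
    · have := vert _ _ hwB
      simp only [add_sub_cancel_right] at this
      simp [this]
    · have := vert _ _ hzB
      simp only [add_sub_cancel_right] at this
      simp [this]
  -- The ray from the face below row `0` sees all of `q`, which starts in column `-1`; the conserved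
  -- quantity is therefore 1 here.
  have hbot : above q (s, 0) = 1 + ind (t ≤ s) := by
    have h1 := above_eq_of_horizontal q (hedge _ hB.left_mem (s + 1, 0))
    rw [← h1, above_of_lt, ind_pos (by simp only; omega)]
    intro w hw
    rcases hq w hw with h | rfl | rfl
    · have := hA' w h; omega
    · simp only; omega
    · simp only; omega
  have hleft := hinv _ hB
  have h1 := above_add_of_vertical q (hedge _ hB.right_mem (0, y₁ + 1))
  -- Only the added step on the left could meet this ray, and it lies below because `y₀ < y₁`. The
  -- conserved quantity is thus 0 at the end of `B`, a contradiction.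
  have h2 : above q (0 - 1, y₁) = 0 := by
    rw [above, above_eq_zero_of_lt_fst, stepAbove, ind_neg, add_zero]
    · simp only; omega
    · intro w hw
      rcases hr w hw with h | rfl
      · have := hA' w h; omega
      · simp only; omega
  have h3 : ind (t = 0 ∧ y₁ < H + 1) = ind (t ≤ 0) := by
    unfold ind
    split_ifs <;> first | rfl | (exfalso; omega)
  simp only [h2, h3, zero_add, ind_neg (show ¬((-1 : ℤ) = 0 ∧ y₁ < y₀) by omega)] at h1
  simp only [h1, hbot, add_assoc, zmod_two_add_self] at hleft
  exact absurd hleft (by decide)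

/-! ### Self-duality -/

/-- The map that sends an edge of the dual lattice to the edge that it crosses, where the vertices
of the dual lattice are the faces, identified with their lower left corners. -/
def dualSym2 : Sym2 (ℤ × ℤ) → Sym2 (ℤ × ℤ) :=
  Sym2.lift ⟨fun u v =>
    s(((u.1 + v.1 + 1 - (v.2 - u.2)) / 2, (u.2 + v.2 + 1 + (v.1 - u.1)) / 2),
      ((u.1 + v.1 + 1 + (v.2 - u.2)) / 2, (u.2 + v.2 + 1 - (v.1 - u.1)) / 2)), fun u v => by
    refine Sym2.eq_swap.trans ?_
    congr 3 <;> congr 1 <;> ring⟩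

theorem dualSym2_vertical (x y : ℤ) : dualSym2 s((x, y - 1), (x, y)) = s((x, y), (x + 1, y)) := by
  simp only [dualSym2, Sym2.lift_mk]
  congr 3 <;> omega

theorem dualSym2_horizontal (x y : ℤ) :
    dualSym2 s((x - 1, y), (x, y)) = s((x, y), (x, y + 1)) := by
  simp only [dualSym2, Sym2.lift_mk]
  rw [Sym2.eq_swap]
  congr 3 <;> omega

theorem exists_eq_of_mem_edgeSet {e : Sym2 (ℤ × ℤ)} (he : e ∈ squareLattice.edgeSet) :
    ∃ x y : ℤ, e = s((x, y - 1), (x, y)) ∨ e = s((x - 1, y), (x, y)) := by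
  induction e with
  | _ u v =>
    rw [SimpleGraph.mem_edgeSet, squareLattice_adj_iff] at he
    obtain ⟨u1, u2⟩ := u
    obtain ⟨v1, v2⟩ := v
    simp only [Prod.mk.injEq] at he
    rcases he with (⟨rfl, rfl⟩ | ⟨rfl, rfl⟩) | (⟨rfl, rfl⟩ | ⟨rfl, rfl⟩)
    · exact ⟨u1 + 1, v2, Or.inr (by simp)⟩
    · exact ⟨v1 + 1, u2, Or.inr (by rw [Sym2.eq_swap]; simp)⟩
    · exact ⟨v1, u2 + 1, Or.inl (by simp)⟩
    · exact ⟨u1, v2 + 1, Or.inl (by rw [Sym2.eq_swap]; simp)⟩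

/-- The edge crossed by an edge of the dual lattice. -/
def dualEdge (e : Edge) : Edge :=
  ⟨dualSym2 e.1, by
    obtain ⟨x, y, h | h⟩ := exists_eq_of_mem_edgeSet e.2
    · rw [h, dualSym2_vertical, SimpleGraph.mem_edgeSet, squareLattice_adj_iff]; simp
    · rw [h, dualSym2_horizontal, SimpleGraph.mem_edgeSet, squareLattice_adj_iff]; simp⟩

theorem dualEdge_injective : Function.Injective dualEdge := by
  rintro ⟨e, he⟩ ⟨e', he'⟩ h
  simp only [dualEdge, Subtype.mk.injEq] at h ⊢
  obtain ⟨x, y, rfl | rfl⟩ := exists_eq_of_mem_edgeSet he <;>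
  obtain ⟨x', y', rfl | rfl⟩ := exists_eq_of_mem_edgeSet he' <;>
  simp only [dualSym2_vertical, dualSym2_horizontal, Sym2.eq_iff, Prod.mk.injEq] at h ⊢ <;>
  omega

/-- The dual configuration: an edge of the dual lattice is open when the edge that it crosses is
closed. -/
def dual (ω : Config) : Config := fun e => !ω (dualEdge e)

theorem pr_dual_preimage {A : Set Config} (hA : MeasurableSet A) : pr (dual ⁻¹' A) = pr A := by
  have h1 : Measurable fun (ω : Config) e => ω (dualEdge e) :=
    measurable_pi_lambda _ fun e => measurable_pi_apply _
  have h2 : Measurable fun (ω : Config) (e : Edge) => !ω e :=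
    measurable_pi_lambda _ fun e =>
      (measurable_from_top (f := fun b : Bool => !b)).comp (measurable_pi_apply e)
  have h := map_not_half
  rw [← map_comp_injective half dualEdge_injective, Measure.map_map h2 h1] at h
  rw [pr, pr, measureReal_def, measureReal_def]
  conv_rhs => rw [← map_comp_injective half dualEdge_injective, ← h]
  rw [Measure.map_apply (h2.comp h1) hA]
  rfl

/-- A rectangle is not crossed by an open path and by a transversal open path of the dual. -/
theorem disjoint_hcross_dual_vcross {n : ℤ} (hn : 0 ≤ n) :
    Disjoint (hcross 0 (n + 1) 0 n) (dual ⁻¹' vcross 0 n (-1) n) := by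
  rw [Set.disjoint_left]
  rintro ω ⟨a, b, ⟨ha, hb⟩, p, hp⟩ ⟨c, d, ⟨hc, hd⟩, hcd⟩
  let q : squareLattice.Walk a b := p.mapLe fun _ _ h => openGraph_le ω h
  have hsup : ∀ w ∈ q.support, w ∈ rect 0 (n + 1) 0 n := fun w hw =>
    hp w (by simpa [q] using hw)
  have hopen : ∀ e (he : e ∈ squareLattice.edgeSet), e ∈ q.edges → ω ⟨e, he⟩ = true := by
    intro e he h
    have : e ∈ p.edges := by simpa [q, SimpleGraph.Walk.edges_mapLe_eq_edges] using h
    have := p.edges_subset_edgeSet this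
    induction e with
    | _ u v =>
      rw [SimpleGraph.mem_edgeSet, openGraph_adj] at this
      exact this.2
  have vert : ∀ x y : ℤ, (openGraph (dual ω)).Adj (x, y - 1) (x, y) →
      above q (x, y - 1) = above q (x, y) := by
    intro x y h
    refine above_eq_of_horizontal q fun hmem => ?_
    rw [openGraph_adj] at h
    obtain ⟨h1, h2⟩ := h
    have h3 := hopen _ (by rw [SimpleGraph.mem_edgeSet, squareLattice_adj_iff]; simp) hmem
    simp only [dual, dualEdge, dualSym2_vertical, h3] at h2
    exact absurd h2 (by decide)
  have hor : ∀ x y : ℤ, (openGraph (dual ω)).Adj (x - 1, y) (x, y) → 0 ≤ x - 1 → x ≤ n →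
      above q (x - 1, y) = above q (x, y) := by
    intro x y h hx hx'
    have hmem : s((x, y), (x, y + 1)) ∉ q.edges := by
      intro hmem
      rw [openGraph_adj] at h
      obtain ⟨h1, h2⟩ := h
      have h3 := hopen _ (by rw [SimpleGraph.mem_edgeSet, squareLattice_adj_iff]; simp) hmem
      simp only [dual, dualEdge, dualSym2_horizontal, h3] at h2
      exact absurd h2 (by decide)
    have := above_add_of_vertical q hmem
    rw [ind_neg (by omega), ind_neg (by omega)] at this
    linear_combination this - zmod_two_add_self (above q (x, y))
  -- Dual open edges cross closed edges, so a dual path never crosses `q`, and the parity can change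
  -- only in the columns of the ends of `q`, which do not interfere here.
  have hinv : above q d = above q c := by
    refine hcd.induction (P := fun z => above q z = above q c) rfl fun z w ih hz hw hzw => ?_
    rw [← ih]
    have hlat := openGraph_le _ hzw
    obtain ⟨z1, z2⟩ := z
    obtain ⟨w1, w2⟩ := w
    rw [squareLattice_adj_iff] at hlat
    simp only [Prod.mk.injEq] at hlat
    have hz1 := hz.1
    have hw1 := hw.1
    simp only at hz1 hw1
    rcases hlat with (⟨rfl, rfl⟩ | ⟨rfl, rfl⟩) | (⟨rfl, rfl⟩ | ⟨rfl, rfl⟩)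
    · have := hor (z1 + 1) w2 (by simpa using hzw) (by omega) (by omega)
      simpa using this.symm
    · have := hor (w1 + 1) z2 (by simpa using hzw.symm) (by omega) (by omega)
      simpa using this
    · have := vert w1 (z2 + 1) (by simpa using hzw)
      simpa using this.symm
    · have := vert z1 (w2 + 1) (by simpa using hzw.symm)
      simpa using this
  have hc1 := hcd.left_mem.1
  obtain ⟨c1, c2⟩ := c
  obtain ⟨d1, d2⟩ := d
  simp only at hc hd hc1
  subst hc hd
  rw [above_eq_zero_of_le _ fun w hw => (hsup w hw).2.2,
    above_of_lt _ fun w hw => by have := (hsup w hw).2.1; omega, ind_pos (by omega),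
    ind_neg (by omega)] at hinv
  exact absurd hinv (by decide)

/-- The rectangle and its transverse dual rectangle are congruent up to a quarter turn, and the dual
has the same law: two disjoint events of equal probability have probability at most 1/2 each. -/
theorem half_le_nv {n m : ℤ} (hn : 0 ≤ n) (hm : n + 1 ≤ m) : 1 / 2 ≤ nv n m := by
  refine le_trans ?_ (nv_mono le_rfl hm (by omega))
  have m1 := (isDecreasing_compl_hcross 0 (n + 1) 0 n).measurableSet.of_compl
  have m2 := (isDecreasing_compl_vcross 0 n (-1) n).measurableSet.of_compl
  have h1 := pr_compl_hcross 0 (n + 1) 0 n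
  have h2 := pr_compl_vcross 0 n (-1) n
  have h3 : pr (hcross 0 (n + 1) 0 n)ᶜ = 1 - pr (hcross 0 (n + 1) 0 n) :=
    probReal_compl_eq_one_sub m1
  have h4 : pr (vcross 0 n (-1) n)ᶜ = 1 - pr (vcross 0 n (-1) n) := probReal_compl_eq_one_sub m2
  have h5 : pr (dual ⁻¹' vcross 0 n (-1) n) ≤ pr (hcross 0 (n + 1) 0 n)ᶜ :=
    pr_mono (disjoint_hcross_dual_vcross hn).symm.subset_compl_right
  rw [pr_dual_preimage m2] at h5
  simp only [sub_zero, sub_neg_eq_add] at h1 h2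
  linarith

/-! ### Russo–Seymour–Welsh: from squares to longer rectangles -/

/-- The vertices of `[0, k + 1] × [1, k]` joined in this rectangle to its left side. -/
def leftCluster (k : ℤ) (ω : Config) : Set (ℤ × ℤ) :=
  {z | ∃ u : ℤ × ℤ, u.1 = 0 ∧ ConnIn (openGraph ω) (rect 0 (k + 1) 1 k) u z}

/-- The image of `D` under the reflection of `[0, 2k] × [0, 2k + 1]` that exchanges bottom and
top. -/
def mirror (k : ℤ) (D : Set (ℤ × ℤ)) : Set (ℤ × ℤ) := reflectY (2 * k + 1) ⁻¹' D

/-- There is an open path in `[0, 2k] × [0, 2k + 1]`, outside `D`, from the bottom to the top or to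
the mirror image of `D`. -/
def escape (k : ℤ) (D : Set (ℤ × ℤ)) : Set Config :=
  connEvent (rect 0 (2 * k) 0 (2 * k + 1) \ D)
    fun u v => u.2 = 0 ∧ (v ∈ mirror k D ∨ v.2 = 2 * k + 1)

variable {k : ℤ}

theorem leftCluster_subset (k : ℤ) (ω : Config) : leftCluster k ω ⊆ rect 0 (k + 1) 1 k := by
  rintro z ⟨u, -, h⟩
  exact h.right_mem

theorem mem_leftCluster_of_adj {ω : Config} {x y : ℤ × ℤ} (hx : x ∈ leftCluster k ω)
    (hy : y ∈ rect 0 (k + 1) 1 k) (h : (openGraph ω).Adj x y) : y ∈ leftCluster k ω := by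
  obtain ⟨u, hu, hx⟩ := hx
  exact ⟨u, hu, hx.tail hy h⟩

theorem mem_leftCluster_of_left (ω : Config) {z : ℤ × ℤ} (hz : z.1 = 0)
    (h1 : 1 ≤ z.2) (h2 : z.2 ≤ k) : z ∈ leftCluster k ω :=
  ⟨z, hz, .refl ⟨⟨by omega, by omega⟩, h1, h2⟩⟩

theorem exists_connIn_leftCluster {ω : Config} {z : ℤ × ℤ} (hz : z ∈ leftCluster k ω) :
    ∃ u : ℤ × ℤ, u.1 = 0 ∧ 1 ≤ u.2 ∧ u.2 ≤ k ∧
      ConnIn squareLattice (leftCluster k ω) u z := by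
  obtain ⟨u, hu, h⟩ := hz
  have h' : ConnIn (openGraph ω) (leftCluster k ω) u z := h.cluster.mono fun w hw => ⟨u, hu, hw⟩
  exact ⟨u, hu, h.left_mem.2.1, h.left_mem.2.2, h'.lattice⟩

/-- Exploring the cluster reveals only edges with an endpoint in `D`, so the edges off `D` remain
independent of this event. -/
theorem dependsOnEdges_leftCluster_eq (k : ℤ) (D : Set (ℤ × ℤ)) :
    DependsOnEdges {ω | leftCluster k ω = D} (edgesIn (rect 0 (k + 1) 1 k) \ edgesIn Dᶜ) := by
  intro ω ω' h (hD : leftCluster k ω = D)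
  have key : ∀ x y, x ∈ D → x ∈ rect 0 (k + 1) 1 k → y ∈ rect 0 (k + 1) 1 k →
      ((openGraph ω).Adj x y ↔ (openGraph ω').Adj x y) := by
    intro x y hx hxS hyS
    rw [openGraph_adj, openGraph_adj]
    refine exists_congr fun hxy => ?_
    rw [h]
    refine ⟨fun z hz => ?_, fun h' => h' x (Sym2.mem_mk_left x y) hx⟩
    rcases Sym2.mem_iff.1 hz with rfl | rfl <;> assumption
  change leftCluster k ω' = D
  apply Set.Subset.antisymm
  · rintro z ⟨u, hu, huz⟩
    have huD : u ∈ D := hD ▸ ⟨u, hu, .refl huz.left_mem⟩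
    refine huz.induction (P := (· ∈ D)) huD fun x y hx hxS hyS hxy => ?_
    rw [← hD] at hx ⊢
    exact mem_leftCluster_of_adj hx hyS ((key x y (hD ▸ hx) hxS hyS).2 hxy)
  · intro z hz
    rw [← hD] at hz
    obtain ⟨u, hu, huz⟩ := hz
    refine huz.cluster.induction (P := (· ∈ leftCluster k ω')) ⟨u, hu, .refl huz.left_mem⟩
      fun x y hx hxu hyu hxy => ?_
    have hxu' : ConnIn (openGraph ω) (rect 0 (k + 1) 1 k) u x := hxu
    have hyu' : ConnIn (openGraph ω) (rect 0 (k + 1) 1 k) u y := hyu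
    exact mem_leftCluster_of_adj hx hyu'.right_mem
      ((key x y (hD ▸ ⟨u, hu, hxu'⟩) hxu'.right_mem hyu'.right_mem).1 hxy)

theorem connIn_pull_reflectY {ω : Config} {c : ℤ} {A : Set (ℤ × ℤ)} {u v : ℤ × ℤ}
    (h : ConnIn (openGraph (pull (reflectY c) ω)) A u v) :
    ConnIn (openGraph ω) (reflectY c ⁻¹' A) (reflectY c u) (reflectY c v) := by
  rw [← connIn_pull_iff]
  convert! h
  ext z
  simp

/-- If neither path alone crosses, one joins the bottom to the mirror image of `D` and the other
joins `D` to the top. Prolonged to the left side inside those two sets, they must meet. -/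
theorem escape_inter_subset (D : Set (ℤ × ℤ)) (hD : ∃ ω, leftCluster k ω = D) :
    escape k D ∩ pull (reflectY (2 * k + 1)) ⁻¹' escape k D ⊆ vcross 0 (2 * k) 0 (2 * k + 1) := by
  rintro ω ⟨⟨u, v, ⟨hu, hv⟩, huv⟩, ⟨u', v', ⟨hu', hv'⟩, huv'⟩⟩
  obtain ⟨ω₀, hω₀⟩ := hD
  have hsub : ∀ z ∈ D, (0 ≤ z.1 ∧ z.1 ≤ k + 1) ∧ 1 ≤ z.2 ∧ z.2 ≤ k := fun z hz =>
    leftCluster_subset k ω₀ (hω₀ ▸ hz)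
  replace huv' := connIn_pull_reflectY huv'
  obtain ⟨s, hs⟩ : ∃ s, s = reflectY (2 * k + 1) u' := ⟨_, rfl⟩
  obtain ⟨t, ht⟩ : ∃ t, t = reflectY (2 * k + 1) v' := ⟨_, rfl⟩
  rw [← hs, ← ht] at huv'
  have hs2 : s.2 = 2 * k + 1 := by rw [hs]; simp [hu']
  have hR : ∀ z ∈ reflectY (2 * k + 1) ⁻¹' (rect 0 (2 * k) 0 (2 * k + 1) \ D),
      z ∈ rect 0 (2 * k) 0 (2 * k + 1) := by
    rintro z ⟨⟨h1, h2⟩, -⟩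
    simp only [reflectY_apply] at h1 h2
    exact ⟨h1, by omega, by omega⟩
  have hur := huv.left_mem.1
  have hsr := hR _ huv'.left_mem
  have hk : 0 ≤ 2 * k + 1 := hur.2.1.trans hur.2.2
  rcases hv with hv | hv
  swap
  · exact ⟨u, v, ⟨hu, hv⟩, huv.mono Set.sdiff_subset⟩
  rcases hv' with hv' | hv'
  swap
  · exact ⟨t, s, ⟨by rw [ht]; simp [hv'], hs2⟩, huv'.symm.mono hR⟩
  have htD : t ∈ D := by rw [ht]; exact hv'
  obtain ⟨a, ha, ha1, ha2, hat⟩ := exists_connIn_leftCluster (hω₀.symm ▸ htD)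
  obtain ⟨b, hb, hb1, hb2, hbv⟩ := exists_connIn_leftCluster
    (hω₀.symm ▸ hv : reflectY (2 * k + 1) v ∈ leftCluster k ω₀)
  rw [hω₀] at hat hbv
  have hbv' : ConnIn squareLattice (mirror k D) (reflectY (2 * k + 1) b) v := by
    have := hbv.map (G' := squareLattice) (B := mirror k D) (reflectY (2 * k + 1))
      (fun z hz => by simpa [mirror] using hz)
      (fun x _ y _ h => (reflectY (2 * k + 1)).map_adj_iff.2 h)
    simpa using this
  have hmir : ∀ z ∈ mirror k D, (0 ≤ z.1 ∧ z.1 ≤ k + 1) ∧ k + 1 ≤ z.2 ∧ z.2 ≤ 2 * k := by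
    intro z hz
    have := hsub _ hz
    simp only [reflectY_apply] at this
    omega
  have hA : ConnIn squareLattice (D ∪ {z | ConnIn (openGraph ω)
      (reflectY (2 * k + 1) ⁻¹' (rect 0 (2 * k) 0 (2 * k + 1) \ D)) s z})
      (0, a.2) (s.1, 2 * k + 1) := by
    have e1 : ((0 : ℤ), a.2) = a := by rw [← ha]
    have e2 : (s.1, 2 * k + 1) = s := by rw [← hs2]
    rw [e1, e2]
    exact (hat.mono Set.subset_union_left).trans
      (huv'.cluster.lattice.symm.mono Set.subset_union_right)
  have hB : ConnIn squareLattice (mirror k D ∪ {z | ConnIn (openGraph ω)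
      (rect 0 (2 * k) 0 (2 * k + 1) \ D) u z}) (u.1, 0) (0, 2 * k + 1 - b.2) := by
    have e1 : (u.1, (0 : ℤ)) = u := by rw [← hu]
    have e2 : ((0 : ℤ), 2 * k + 1 - b.2) = reflectY (2 * k + 1) b := by simp [hb]
    rw [e1, e2]
    exact (huv.cluster.lattice.mono Set.subset_union_right).trans
      (hbv'.symm.mono Set.subset_union_left)
  obtain ⟨z, hzA, hzB⟩ := inter_nonempty_of_connIn hA hB (by
      rintro z (hz | hz)
      · have := hsub z hz; omega
      · have := hR z (ConnIn.right_mem hz); exact ⟨this.1.1, this.2⟩) (by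
      rintro z (hz | hz)
      · have := hmir z hz; omega
      · have := (ConnIn.right_mem hz).1; exact ⟨this.1.1, this.2⟩) (by omega)
  -- `D` and its mirror image lie in disjoint strips, and each open path avoids the set used to
  -- prolong the other. The common vertex is therefore on both open paths.
  rcases hzA with hzA | hzA
  · exfalso
    rcases hzB with hzB | hzB
    · have h1 := hsub z hzA
      have h2 := hmir z hzB
      omega
    · exact (ConnIn.right_mem hzB).2 hzA
  · rcases hzB with hzB | hzB
    · exact absurd hzB (ConnIn.right_mem hzA).2
    · exact ⟨u, s, ⟨hu, hs2⟩, (ConnIn.mono hzB Set.sdiff_subset).trans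
        (ConnIn.mono hzA hR).symm⟩

theorem measurableSet_escape (k : ℤ) (D : Set (ℤ × ℤ)) : MeasurableSet (escape k D) :=
  measurableSet_connEvent ((rect_finite _ _ _ _).subset Set.sdiff_subset) _

/-- An escape and a mirrored escape together force a crossing that is absent with probability at
least 1/2. Each is absent with the same probability, so the union bound gives half of that. -/
theorem quarter_le_pr_compl_escape (hk : 0 ≤ k) (D : Set (ℤ × ℤ))
    (hD : ∃ ω, leftCluster k ω = D) : 1 / 4 ≤ pr (escape k D)ᶜ := by
  have h1 : 1 / 2 ≤ nv (2 * k) (2 * k + 1) := half_le_nv (by omega) le_rfl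
  have h2 : nv (2 * k) (2 * k + 1) ≤
      pr ((escape k D)ᶜ ∪ pull (reflectY (2 * k + 1)) ⁻¹' (escape k D)ᶜ) := by
    refine pr_mono ?_
    rw [Set.preimage_compl, ← Set.compl_inter, Set.compl_subset_compl]
    exact escape_inter_subset D hD
  have h3 : pr ((escape k D)ᶜ ∪ pull (reflectY (2 * k + 1)) ⁻¹' (escape k D)ᶜ) ≤ _ :=
    measureReal_union_le _ _
  have h4 := pr_pull_preimage (reflectY (2 * k + 1)) (measurableSet_escape k D).compl
  simp only [pr] at *
  linarith

theorem mem_hcross_of_mem_leftCluster {ω : Config} {z : ℤ × ℤ} (hz : z ∈ leftCluster k ω)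
    (h : z.1 = k + 1) : ω ∈ hcross 0 (k + 1) 1 k := by
  obtain ⟨u, hu, huz⟩ := hz
  exact ⟨u, z, ⟨hu, h⟩, huz⟩

/-- The absence of a crossing of the square is a property of the left cluster alone. Summing over
its possible values `D`, each independent of `escape k D`, gives 1/2 times 1/4. -/
theorem eighth_le_pr_not_escape (hk : 1 ≤ k) :
    1 / 8 ≤ pr {ω | ω ∉ hcross 0 (k + 1) 1 k ∧ ω ∉ escape k (leftCluster k ω)} := by
  classical
  let T : Set (Set (ℤ × ℤ)) := leftCluster k '' (hcross 0 (k + 1) 1 k)ᶜ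
  have hT : T.Finite := (rect_finite 0 (k + 1) 1 k).finite_subsets.subset (by
    rintro _ ⟨ω, -, rfl⟩
    exact leftCluster_subset k ω)
  have hfin := edgesIn_finite (rect_finite 0 (k + 1) 1 k)
  have hmeas : ∀ D : Set (ℤ × ℤ), MeasurableSet {ω | leftCluster k ω = D} := fun D =>
    (dependsOnEdges_leftCluster_eq k D).measurableSet (hfin.subset Set.sdiff_subset)
  have h1 : 1 / 2 ≤ pr (hcross 0 (k + 1) 1 k)ᶜ := by
    rw [pr_compl_hcross]
    exact half_le_nv (by omega) (by omega)
  have h2 : pr (hcross 0 (k + 1) 1 k)ᶜ ≤ ∑ D ∈ hT.toFinset, pr {ω | leftCluster k ω = D} := by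
    refine (pr_mono ?_).trans (measureReal_biUnion_finset_le _ _)
    intro ω hω
    simp only [Set.mem_iUnion]
    exact ⟨leftCluster k ω, by simpa using ⟨ω, hω, rfl⟩, rfl⟩
  have h3 : ∀ D ∈ hT.toFinset, pr {ω | leftCluster k ω = D} * (1 / 4) ≤
      pr ({ω | leftCluster k ω = D} ∩ (escape k D)ᶜ) := by
    intro D hD
    have hD' : ∃ ω, leftCluster k ω = D := by
      obtain ⟨ω, -, h⟩ := hT.mem_toFinset.1 hD
      exact ⟨ω, h⟩
    have := (dependsOnEdges_leftCluster_eq k D).measureReal_inter half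
      (dependsOnEdges_connEvent (rect 0 (2 * k) 0 (2 * k + 1) \ D)
        fun u v => u.2 = 0 ∧ (v ∈ mirror k D ∨ v.2 = 2 * k + 1)).compl
      (hfin.subset Set.sdiff_subset)
      (edgesIn_finite ((rect_finite _ _ _ _).subset Set.sdiff_subset))
      (Set.disjoint_sdiff_left.mono_right (edgesIn_mono fun z hz => hz.2))
    have h4 : pr ({ω | leftCluster k ω = D} ∩ (escape k D)ᶜ) =
      pr {ω | leftCluster k ω = D} * pr (escape k D)ᶜ := this
    rw [h4]
    exact mul_le_mul_of_nonneg_left (quarter_le_pr_compl_escape (by omega) D hD') (pr_nonneg _)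
  have h4 : ∑ D ∈ hT.toFinset, pr ({ω | leftCluster k ω = D} ∩ (escape k D)ᶜ) ≤
      pr {ω | ω ∉ hcross 0 (k + 1) 1 k ∧ ω ∉ escape k (leftCluster k ω)} := by
    unfold pr
    rw [← measureReal_biUnion_finset]
    · refine measureReal_mono ?_
      intro ω hω
      simp only [Set.mem_iUnion] at hω
      obtain ⟨D, hD, hω1 : leftCluster k ω = D, hω2⟩ := hω
      obtain ⟨ω', hω', h'⟩ := hT.mem_toFinset.1 hD
      refine ⟨?_, hω1 ▸ hω2⟩
      rintro ⟨u, v, ⟨hu, hv⟩, huv⟩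
      have : v ∈ leftCluster k ω' := by rw [h', ← hω1]; exact ⟨u, hu, huv⟩
      exact hω' (mem_hcross_of_mem_leftCluster this hv)
    · intro D _ D' _ hne
      refine Set.disjoint_left.2 fun ω h h' => hne ?_
      exact (show leftCluster k ω = D from h.1).symm.trans h'.1
    · exact fun D _ => (hmeas D).inter (measurableSet_escape k D).compl
  have h5 := (Finset.sum_le_sum h3).trans h4
  rw [← Finset.sum_mul] at h5
  linarith

/-- There is an open path from the bottom of `[0, 2k] × [0, 2k + 1]` to its left side or its top
that first goes to the right of `[0, k] × [1, k]`. -/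
def detour (k : ℤ) : Set Config :=
  {ω | ∃ u₀ u w v : ℤ × ℤ, u₀.2 = 0 ∧ u.2 = 1 ∧ (openGraph ω).Adj u₀ u ∧
    (k + 1 ≤ w.1 ∧ ConnIn (openGraph ω) (rect 0 (2 * k) 1 k) u w) ∧
    (v.1 = 0 ∨ v.2 = 2 * k + 1) ∧ ConnIn (openGraph ω) (rect 0 (2 * k) 1 (2 * k + 1)) u v}

theorem fst_eq_of_adj {x y : ℤ × ℤ} (h : squareLattice.Adj x y) (h' : x.2 ≠ y.2) : x.1 = y.1 := by
  rw [squareLattice_adj_iff] at h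
  rcases h with (h | h) | (h | h)
  · exact absurd (by rw [h]) h'
  · exact absurd (by rw [h]) h'
  · rw [h]
  · rw [h]

theorem isDecreasing_compl_detour (k : ℤ) : IsDecreasing (detour k)ᶜ := by
  constructor
  · refine ⟨edgesIn (rect 0 (2 * k) 0 (2 * k + 1)), edgesIn_finite (rect_finite _ _ _ _),
      DependsOnEdges.compl ?_⟩
    rintro ω ω' h ⟨u₀, u, w, v, h0, h1, h2, ⟨h3, h4⟩, h5, h6⟩
    have hu := h6.left_mem
    have hfst := fst_eq_of_adj (openGraph_le ω h2) (by omega)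
    have hle : ∀ z : ℤ × ℤ, z ∈ rect 0 (2 * k) 1 (2 * k + 1) →
        z ∈ rect 0 (2 * k) 0 (2 * k + 1) := fun z hz => ⟨hz.1, by have := hz.2; omega⟩
    have hle' : ∀ z : ℤ × ℤ, z ∈ rect 0 (2 * k) 1 k →
        z ∈ rect 0 (2 * k) 0 (2 * k + 1) := fun z hz => ⟨hz.1, by have := hz.2; omega⟩
    refine ⟨u₀, u, w, v, h0, h1, openGraph_adj_congr h ?_ (hle u hu) h2,
      ⟨h3, h4.congr_config fun e he => h e (edgesIn_mono hle' he)⟩, h5,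
      h6.congr_config fun e he => h e (edgesIn_mono hle he)⟩
    have := (hle u hu).2.2
    exact ⟨hfst ▸ hu.1, by omega⟩
  · refine IsUpperSet.compl ?_
    rintro ω ω' h ⟨u₀, u, w, v, h0, h1, h2, ⟨h3, h4⟩, h5, h6⟩
    exact ⟨u₀, u, w, v, h0, h1, openGraph_adj_mono h h2, ⟨h3, h4.mono_config h⟩, h5,
      h6.mono_config h⟩

/-- The escape event for the random cluster need not be monotone, whereas `detour` is increasing and
so can enter the Harris inequality. A detour starts off the cluster, since otherwise the square
would be crossed. The cluster and its mirror image contain the left side in rows `1` to `2 * k`, so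
the detour reaches one of them or the top. -/
theorem not_detour_of_not_escape (hk : 1 ≤ k) {ω : Config} (h1 : ω ∉ hcross 0 (k + 1) 1 k)
    (h2 : ω ∉ escape k (leftCluster k ω)) : ω ∉ detour k := by
  rintro ⟨u₀, u, w, v, hu₀, hu, hadj, ⟨hw, huw⟩, hv, huv⟩
  obtain ⟨E, hE⟩ : ∃ E, E = leftCluster k ω := ⟨_, rfl⟩
  have hsub : ∀ z ∈ E, (0 ≤ z.1 ∧ z.1 ≤ k + 1) ∧ 1 ≤ z.2 ∧ z.2 ≤ k := fun z hz =>
    leftCluster_subset k ω (hE ▸ hz)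
  have hmir : ∀ z ∈ mirror k E, (0 ≤ z.1 ∧ z.1 ≤ k + 1) ∧ k + 1 ≤ z.2 ∧ z.2 ≤ 2 * k := by
    intro z hz
    have := hsub _ hz
    simp only [reflectY_apply] at this
    omega
  have huE : u ∉ E := by
    rw [hE]
    rintro ⟨z, hz, hzu⟩
    refine h1 (mem_hcross_of_connIn (A := {z | 1 ≤ z.2 ∧ z.2 ≤ k}) ((hzu.mono ?_).trans
      (huw.mono ?_)) (fun z hz => hz) (by omega) hz.le hw)
    · exact fun z hz => hz.2
    · exact fun z hz => hz.2
  have hfst := fst_eq_of_adj (openGraph_le ω hadj) (by omega)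
  have hur := huv.left_mem
  have hu₀R : u₀ ∈ rect 0 (2 * k) 0 (2 * k + 1) \ E :=
    ⟨⟨hfst ▸ hur.1, by omega, by omega⟩, fun h => by have := hsub _ h; omega⟩
  have hstart : ∀ z, ConnIn (openGraph ω) (rect 0 (2 * k) 1 (2 * k + 1) ∩
      {z | z ∉ E ∧ z ∉ mirror k E}) u z →
      ConnIn (openGraph ω) (rect 0 (2 * k) 0 (2 * k + 1) \ E) u₀ z := by
    intro z hz
    have hz' : ConnIn (openGraph ω) (rect 0 (2 * k) 0 (2 * k + 1) \ E) u z :=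
      hz.mono fun y hy => ⟨⟨hy.1.1, by have := hy.1.2; omega⟩, hy.2.1⟩
    exact (ConnIn.of_adj hu₀R hz'.left_mem hadj).trans hz'
  have hesc : ∀ z, ConnIn (openGraph ω) (rect 0 (2 * k) 0 (2 * k + 1) \ E) u₀ z →
      z ∉ mirror k E ∧ z.2 ≠ 2 * k + 1 := by
    intro z hz
    rw [← hE] at h2
    exact ⟨fun h => h2 ⟨u₀, z, ⟨hu₀, Or.inl h⟩, hz⟩, fun h => h2 ⟨u₀, z, ⟨hu₀, Or.inr h⟩, hz⟩⟩
  rcases huv.exit (B := {z | z ∉ E ∧ z ∉ mirror k E})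
    ⟨huE, fun h => by have := hmir _ h; omega⟩ with h | ⟨x, y, hx, hxy, hyR, hy⟩
  · have hvtop := (hesc v (hstart v h)).2
    have hvr := h.right_mem
    rcases hv with hv | hv
    · have h3 := hvr.1.2
      by_cases h4 : v.2 ≤ k
      · exact hvr.2.1 (hE ▸ mem_leftCluster_of_left ω hv h3.1 h4)
      · refine hvr.2.2 ?_
        change reflectY (2 * k + 1) v ∈ E
        rw [hE]
        refine mem_leftCluster_of_left ω (by simpa using hv) ?_ ?_ <;>
        · simp only [reflectY_apply]; omega
    · exact hvtop hv
  · have hx' := hstart x hx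
    have hxr := hx.right_mem
    by_cases hyE : y ∈ E
    · have hy1 := hsub y hyE
      have hy2 : y.1 ≠ k + 1 := fun h => h1 (mem_hcross_of_mem_leftCluster (hE ▸ hyE) h)
      have hx1 := hxr.1
      by_cases hxS : x ∈ rect 0 (k + 1) 1 k
      · refine hxr.2.1 ?_
        rw [hE] at hyE ⊢
        exact mem_leftCluster_of_adj hyE hxS hxy.symm
      · have hxS' : ¬((0 ≤ x.1 ∧ x.1 ≤ k + 1) ∧ 1 ≤ x.2 ∧ x.2 ≤ k) := hxS
        have hx2 : (0 ≤ x.1 ∧ x.1 ≤ 2 * k) ∧ 1 ≤ x.2 ∧ x.2 ≤ 2 * k + 1 := hx1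
        refine hxr.2.2 ?_
        change (x.1, 2 * k + 1 - x.2) ∈ E
        -- The cluster can be entered by an open edge only from outside its rectangle. The right
        -- side is excluded because there is no crossing, so the entrance is from row `k + 1`,
        -- directly above, where `x` is the mirror image of `y`.
        have h5 : x = (y.1, y.2 + 1) ∧ y.2 = k := by
          have := openGraph_le ω hxy
          rw [squareLattice_adj_iff] at this
          obtain ⟨x1, x2⟩ := x
          obtain ⟨y1, y2⟩ := y
          simp only [Prod.mk.injEq] at *
          omega
        rw [h5.1, h5.2]
        convert hyE using 1
        ext
        · rfl
        · simp only; omega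
    · refine (hesc y (hx'.tail ⟨⟨hyR.1, by have := hyR.2; omega⟩, hyE⟩ hxy)).1 ?_
      by_contra h
      exact hy ⟨hyE, h⟩

/-- Neither a crossing of the square nor a detour around it. -/
def barrier (k : ℤ) : Set Config := (hcross 0 (k + 1) 1 k)ᶜ ∩ (detour k)ᶜ

theorem isDecreasing_barrier (k : ℤ) : IsDecreasing (barrier k) :=
  (isDecreasing_compl_hcross _ _ _ _).inter (isDecreasing_compl_detour k)

theorem eighth_le_pr_barrier (hk : 1 ≤ k) : 1 / 8 ≤ pr (barrier k) :=
  (eighth_le_pr_not_escape hk).trans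
    (pr_mono fun _ h => ⟨h.1, not_detour_of_not_escape hk h.1 h.2⟩)

theorem detour_of_connIn {ω : Config} {u₀ u w v : ℤ × ℤ} (hu₀ : u₀.2 = 0) (hu : u.2 = 1)
    (hadj : (openGraph ω).Adj u₀ u) (hw : k + 1 ≤ w.1)
    (huw : ConnIn (openGraph ω) (rect 0 (2 * k) 1 k) u w)
    (huv : ConnIn (openGraph ω) (rect (1 - k) (2 * k) 1 (2 * k + 1)) u v)
    (hv : v.2 = 2 * k + 1) : ω ∈ detour k := by
  rcases huv.exit (B := {z : ℤ × ℤ | 0 ≤ z.1}) huw.left_mem.1.1 with h | ⟨x, y, hx, hxy, hyR, hy⟩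
  · exact ⟨u₀, u, w, v, hu₀, hu, hadj, ⟨hw, huw⟩, Or.inr hv,
      h.mono fun z hz => ⟨⟨hz.2, hz.1.1.2⟩, hz.1.2⟩⟩
  · refine ⟨u₀, u, w, x, hu₀, hu, hadj, ⟨hw, huw⟩, Or.inl ?_,
      hx.mono fun z hz => ⟨⟨hz.2, hz.1.1.2⟩, hz.1.2⟩⟩
    have h1 := openGraph_adj_fst x y hxy
    have h2 : 0 ≤ x.1 := hx.right_mem.2
    have h3 : ¬0 ≤ y.1 := hy
    rw [abs_le] at h1
    omega

theorem detour_pull_of_connIn {ω : Config} {u₀ u w v : ℤ × ℤ} (hu₀ : u₀.2 = 0) (hu : u.2 = 1)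
    (hadj : (openGraph ω).Adj u₀ u) (hw : w.1 ≤ 0)
    (huw : ConnIn (openGraph ω) (rect (1 - k) (k + 1) 1 k) u w)
    (huv : ConnIn (openGraph ω) (rect (1 - k) (2 * k) 1 (2 * k + 1)) u v)
    (hv : v.2 = 2 * k + 1) : pull (reflectX (k + 1)) ω ∈ detour k := by
  have key : ∀ {A : Set (ℤ × ℤ)} {x y : ℤ × ℤ}, ConnIn (openGraph ω) A x y →
      ConnIn (openGraph (pull (reflectX (k + 1)) ω)) (reflectX (k + 1) ⁻¹' A)
        (reflectX (k + 1) x) (reflectX (k + 1) y) := by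
    intro A x y h
    rw [connIn_pull_iff]
    simpa using h
  refine detour_of_connIn (u₀ := reflectX (k + 1) u₀) (u := reflectX (k + 1) u)
    (w := reflectX (k + 1) w) (v := reflectX (k + 1) v) hu₀ hu ?_ ?_ ((key huw).mono ?_)
    ((key huv).mono ?_) hv
  · rw [openGraph_pull_adj]
    simpa using hadj
  · simp only [reflectX_apply]; omega
  · rintro z ⟨h1, h2⟩
    simp only [reflectX_apply] at h1 h2
    exact ⟨by omega, h2⟩
  · rintro z ⟨h1, h2⟩
    simp only [reflectX_apply] at h1 h2
    exact ⟨by omega, h2⟩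

/-- After its last step from row `0`, a crossing starts beside the square `[1, k] × [1, k]`, or in
it and leaves it on the right, on the left or at the top. These cases give a detour, a reflected
detour or a crossing of the central rectangle. -/
theorem not_vcross_of_barrier (hk : 1 ≤ k) :
    barrier k ∩ pull (reflectX (k + 1)) ⁻¹' barrier k ∩ (vcross 1 k 0 (k + 1))ᶜ ⊆
      (vcross (1 - k) (2 * k) 0 (2 * k + 1))ᶜ := by
  rintro ω ⟨⟨⟨-, n1⟩, ⟨-, n2⟩⟩, n3⟩ ⟨a, v, ⟨ha, hv⟩, hav⟩
  -- The last passage from row `0` to row `1` is the first exit of the reversed path from the rows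
  -- above `0`.
  obtain ⟨u, u₀, hvu, hadj, hu₀R, hu₀⟩ : ∃ w w', ConnIn (openGraph ω)
      (rect (1 - k) (2 * k) 0 (2 * k + 1) ∩ {z : ℤ × ℤ | 1 ≤ z.2}) v w ∧
      (openGraph ω).Adj w w' ∧ w' ∈ rect (1 - k) (2 * k) 0 (2 * k + 1) ∧
      w' ∉ {z : ℤ × ℤ | 1 ≤ z.2} := by
    refine (hav.symm.exit (show v ∈ {z : ℤ × ℤ | 1 ≤ z.2} from ?_)).resolve_left fun h => ?_
    · change 1 ≤ v.2; omega
    · have : 1 ≤ a.2 := h.right_mem.2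
      omega
  have huv : ConnIn (openGraph ω) (rect (1 - k) (2 * k) 1 (2 * k + 1)) u v :=
    hvu.symm.mono fun z hz => ⟨hz.1.1, hz.2, hz.1.2.2⟩
  replace hu₀ : ¬1 ≤ u₀.2 := hu₀
  have hu₀' : u₀.2 = 0 := by have := hu₀R.2; omega
  have hur : ((1 - k ≤ u.1) ∧ u.1 ≤ 2 * k) ∧ 1 ≤ u.2 ∧ u.2 ≤ 2 * k + 1 := huv.left_mem
  have hu : u.2 = 1 := by
    have := openGraph_adj_snd _ _ hadj
    rw [abs_le] at this
    omega
  have hfst := fst_eq_of_adj (openGraph_le ω hadj) (by omega)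
  by_cases c1 : k + 1 ≤ u.1
  · exact n1 (detour_of_connIn hu₀' hu hadj.symm c1
      (.refl ⟨⟨by omega, by omega⟩, by omega, by omega⟩) huv hv)
  by_cases c2 : u.1 ≤ 0
  · exact n2 (detour_pull_of_connIn hu₀' hu hadj.symm c2
      (.refl ⟨⟨by omega, by omega⟩, by omega, by omega⟩) huv hv)
  rcases huv.exit (B := rect 1 k 1 k) ⟨⟨by omega, by omega⟩, by omega, by omega⟩ with
    h | ⟨x, y, hux, hxy, hyR, hy⟩
  · have := h.right_mem.2.2.2
    omega
  · have hx : (1 ≤ x.1 ∧ x.1 ≤ k) ∧ 1 ≤ x.2 ∧ x.2 ≤ k := hux.right_mem.2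
    have hy' : ¬((1 ≤ y.1 ∧ y.1 ≤ k) ∧ 1 ≤ y.2 ∧ y.2 ≤ k) := hy
    have hyR' : (1 - k ≤ y.1 ∧ y.1 ≤ 2 * k) ∧ 1 ≤ y.2 ∧ y.2 ≤ 2 * k + 1 := hyR
    have hle : ∀ {B : Set (ℤ × ℤ)}, rect 1 k 1 k ⊆ B → y ∈ B →
        ConnIn (openGraph ω) B u y := fun hB hyB =>
      (hux.mono fun z hz => hB hz.2).tail hyB hxy
    have hxy' := openGraph_le ω hxy
    rw [squareLattice_adj_iff] at hxy'
    have cases3 : (y.1 = k + 1 ∧ y.2 ≤ k) ∨ (y.1 = 0 ∧ y.2 ≤ k) ∨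
        ((1 ≤ y.1 ∧ y.1 ≤ k) ∧ y.2 = k + 1) := by
      obtain ⟨x1, x2⟩ := x
      obtain ⟨y1, y2⟩ := y
      simp only [Prod.mk.injEq] at *
      omega
    rcases cases3 with ⟨h1, h2⟩ | ⟨h1, h2⟩ | ⟨h1, h2⟩
    · refine n1 (detour_of_connIn hu₀' hu hadj.symm h1.ge (hle ?_ ?_) huv hv)
      · rintro z ⟨h3, h4⟩; exact ⟨by omega, h4⟩
      · exact ⟨by omega, by omega⟩
    · refine n2 (detour_pull_of_connIn hu₀' hu hadj.symm h1.le (hle ?_ ?_) huv hv)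
      · rintro z ⟨h3, h4⟩; exact ⟨by omega, h4⟩
      · exact ⟨by omega, by omega⟩
    · have h3 : ConnIn (openGraph ω) (rect 1 k 0 (k + 1)) u y := by
        refine hle ?_ ?_
        · rintro z ⟨h3, h4⟩; exact ⟨h3, by omega⟩
        · exact ⟨h1, by omega⟩
      refine n3 ⟨u₀, y, ⟨hu₀', h2⟩, (ConnIn.of_adj ?_ h3.left_mem hadj.symm).trans h3⟩
      exact ⟨by omega, by omega⟩

theorem isDecreasing_pull_barrier (k c : ℤ) :
    IsDecreasing (pull (reflectX c) ⁻¹' barrier k) := by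
  obtain ⟨F, hF, h⟩ := (isDecreasing_barrier k).exists_finite
  refine ⟨⟨(reflectX c).mapEdgeSet '' F, hF.image _, fun ω ω' hω => h _ _ fun e he =>
    hω _ ⟨e, he, rfl⟩⟩, fun ω ω' hle => (isDecreasing_barrier k).isLowerSet fun e => hle _⟩

/-- A crossing estimate for rectangles of aspect ratio close to `3 / 2`. -/
theorem le_nv_three_halves (hk : 1 ≤ k) : 1 / 128 ≤ nv (3 * k - 1) (2 * k + 1) := by
  have d1 := isDecreasing_barrier k
  have d2 := isDecreasing_pull_barrier k (k + 1)
  have d3 := isDecreasing_compl_vcross 1 k 0 (k + 1)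
  have h1 := eighth_le_pr_barrier hk
  have h2 := pr_pull_preimage (reflectX (k + 1)) d1.measurableSet
  have h3 : 1 / 2 ≤ pr (vcross 1 k 0 (k + 1))ᶜ := by
    rw [pr_compl_vcross]
    exact half_le_nv (by omega) (by omega)
  have h4 := pr_compl_vcross (1 - k) (2 * k) 0 (2 * k + 1)
  rw [show 2 * k - (1 - k) = 3 * k - 1 by ring, sub_zero] at h4
  rw [← h4]
  refine le_trans ?_ (pr_mono (not_vcross_of_barrier hk))
  refine le_trans ?_ ((d1.inter d2).mul_le_pr_inter d3)
  have h5 := d1.mul_le_pr_inter d2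
  rw [h2] at h5
  nlinarith [mul_le_mul h1 h1 (by norm_num) (pr_nonneg _)]

/-- Two copies are glued with overlap `h + 1`, the least width for which `half_le_nv` controls the
horizontal crossing of the overlap. -/
theorem nv_double {w h : ℤ} (hh : 0 ≤ h) {c : ℝ} (hc : 0 ≤ c) (hw : c ≤ nv w h) :
    c ^ 2 / 2 ≤ nv (2 * w - (h + 1)) h := by
  have h1 := nv_glue (w₁ := w) (w₂ := w) (o := h + 1) (h := h) (by omega) hh
  have h2 : 1 / 2 ≤ nv h (h + 1) := half_le_nv hh le_rfl
  rw [show w + w - (h + 1) = 2 * w - (h + 1) by ring] at h1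
  refine le_trans ?_ h1
  have h3 := mul_le_mul hw hw hc (hc.trans hw)
  have h4 := mul_le_mul h3 h2 (by norm_num) (mul_nonneg (hc.trans hw) (hc.trans hw))
  linarith

/-- **Russo–Seymour–Welsh**: long rectangles are crossed in the short direction with probability
bounded away from one. -/
theorem exists_le_nv : ∃ c : ℝ, 0 < c ∧ ∀ n : ℤ, 8 ≤ n → c ≤ nv (6 * n) (2 * n - 1) := by
  -- With `k = n - 1` the height is `2 * n - 1`, and three doublings lead to width `10 * n - 32`,
  -- which is at least `6 * n` exactly when `8 ≤ n`.
  refine ⟨((((1 / 128) ^ 2 / 2) ^ 2 / 2) ^ 2 / 2), by positivity, fun n hn => ?_⟩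
  have h0 := le_nv_three_halves (k := n - 1) (by omega)
  have h1 := nv_double (by omega) (by norm_num) h0
  have h2 := nv_double (by omega) (by norm_num) h1
  have h3 := nv_double (by omega) (by norm_num) h2
  refine h3.trans (nv_mono ?_ ?_ ?_) <;> omega

/-! ### Decay of the one-arm probability -/

/-- The origin is joined to the boundary of the box `[-n, n]²` inside this box. -/
def arm (n : ℤ) : Set Config := connEvent (box n) fun u v => u = (0, 0) ∧ v ∈ boxBoundary n

theorem mem_box {n : ℤ} {z : ℤ × ℤ} :
    z ∈ box n ↔ (-n ≤ z.1 ∧ z.1 ≤ n) ∧ -n ≤ z.2 ∧ z.2 ≤ n := by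
  simp [box, abs_le]

theorem box_finite (n : ℤ) : (box n).Finite :=
  (rect_finite (-n) n (-n) n).subset fun _ hz => mem_box.1 hz

theorem mem_arm_of_reachable {n : ℤ} (hn : 1 ≤ n) {ω : Config} {v : ℤ × ℤ}
    (h : (openGraph ω).Reachable (0, 0) v) (hv : v ∉ box (n - 1)) : ω ∈ arm n := by
  have h0 : ((0, 0) : ℤ × ℤ) ∈ box (n - 1) := by rw [mem_box]; simp; omega
  rcases (ConnIn.of_reachable h).exit h0 with h' | ⟨x, y, hx, hxy, -, hy⟩
  · exact absurd h'.right_mem.2 hv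
  · have hyn : y ∈ box n := by
      have h1 := mem_box.1 hx.right_mem.2
      have h2 := abs_le.1 (openGraph_adj_fst _ _ hxy)
      have h3 := abs_le.1 (openGraph_adj_snd _ _ hxy)
      rw [mem_box]
      omega
    refine ⟨(0, 0), y, ⟨rfl, hyn, hy⟩, ConnIn.tail (hx.mono fun z hz => ?_) hyn hxy⟩
    have := mem_box.1 hz.2
    rw [mem_box]
    omega

theorem connected_boxBoundary_eq_arm {n : ℤ} (hn : 1 ≤ n) :
    connected {(0, 0)} (boxBoundary n) = arm n := by
  ext ω
  constructor
  · rintro ⟨x, rfl, y, hy, h⟩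
    exact mem_arm_of_reachable hn h hy.2
  · rintro ⟨u, v, ⟨rfl, hv⟩, h⟩
    exact ⟨_, rfl, v, hv, h.reachable⟩

theorem measurableSet_arm (n : ℤ) : MeasurableSet (arm n) :=
  measurableSet_connEvent (box_finite n) _

theorem arm_subset_arm {m n : ℤ} (hm : 1 ≤ m) (hmn : m ≤ n) : arm n ⊆ arm m := by
  rintro ω ⟨u, v, ⟨rfl, hv⟩, h⟩
  refine mem_arm_of_reachable hm h.reachable fun hv' => hv.2 ?_
  rw [mem_box] at hv' ⊢
  omega

theorem IsDecreasing.pow_four_le_pr_inter {A B C D : Set Config} (hA : IsDecreasing A)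
    (hB : IsDecreasing B) (hC : IsDecreasing C) (hD : IsDecreasing D) {c : ℝ} (hc : 0 ≤ c)
    (h1 : c ≤ pr A) (h2 : c ≤ pr B) (h3 : c ≤ pr C) (h4 : c ≤ pr D) :
    c ^ 4 ≤ pr ((A ∩ B) ∩ (C ∩ D)) := by
  refine le_trans ?_ ((hA.inter hB).mul_le_pr_inter (hC.inter hD))
  have h5 := (mul_le_mul h1 h2 hc (pr_nonneg _)).trans (hA.mul_le_pr_inter hB)
  have h6 := (mul_le_mul h3 h4 hc (pr_nonneg _)).trans (hC.mul_le_pr_inter hD)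
  calc c ^ 4 = (c * c) * (c * c) := by ring
    _ ≤ _ := mul_le_mul h5 h6 (by positivity) (pr_nonneg _)

theorem pr_eq_one_sub_of_measurableSet {A : Set Config} (hA : MeasurableSet A) :
    pr A = 1 - pr Aᶜ := by
  have : pr Aᶜ = 1 - pr A := probReal_compl_eq_one_sub hA
  linarith

/-- The four edges at the origin, seen as degenerate rectangles, are all closed with probability at
least 1/16. -/
theorem pr_arm_one : pr (arm 1) ≤ 15 / 16 := by
  have h0 : 1 / 2 ≤ nv 0 1 := half_le_nv le_rfl (by norm_num)
  have h := (isDecreasing_compl_hcross 0 1 0 0).pow_four_le_pr_inter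
    (isDecreasing_compl_hcross (-1) 0 0 0) (isDecreasing_compl_vcross 0 0 0 1)
    (isDecreasing_compl_vcross 0 0 (-1) 0) (c := 1 / 2) (by norm_num)
    (by rw [pr_compl_hcross]; simpa using h0) (by rw [pr_compl_hcross]; simpa using h0)
    (by rw [pr_compl_vcross]; simpa using h0) (by rw [pr_compl_vcross]; simpa using h0)
  rw [pr_eq_one_sub_of_measurableSet (measurableSet_arm 1)]
  refine le_trans (sub_le_sub_left (h.trans (pr_mono ?_)) _) (by norm_num)
  rintro ω ⟨⟨n1, n2⟩, n3, n4⟩ ⟨u, v, ⟨rfl, hv⟩, huv⟩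
  rcases huv.exit (B := {(0, 0)}) rfl with h' | ⟨x, y, hx, hxy, -, -⟩
  · have h1 : v = (0, 0) := h'.right_mem.2
    refine hv.2 ?_
    rw [h1, mem_box]
    simp
  · have hx0 : x = (0, 0) := hx.right_mem.2
    subst hx0
    have hlat := openGraph_le ω hxy
    rw [squareLattice_adj_iff] at hlat
    obtain ⟨y1, y2⟩ := y
    simp only [Prod.mk.injEq] at hlat
    have hadj : ∀ A : Set (ℤ × ℤ), (0, 0) ∈ A → (y1, y2) ∈ A →
        ConnIn (openGraph ω) A (0, 0) (y1, y2) := fun A h1 h2 => .of_adj h1 h2 hxy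
    have h1 : (y1 = 1 ∧ y2 = 0) ∨ (y1 = -1 ∧ y2 = 0) ∨ (y1 = 0 ∧ y2 = 1) ∨
        (y1 = 0 ∧ y2 = -1) := by omega
    rcases h1 with ⟨rfl, rfl⟩ | ⟨rfl, rfl⟩ | ⟨rfl, rfl⟩ | ⟨rfl, rfl⟩
    · exact n1 ⟨_, _, ⟨rfl, rfl⟩, hadj _ (by simp [rect]) (by simp [rect])⟩
    · exact n2 ⟨_, _, ⟨rfl, rfl⟩, (hadj _ (by simp [rect]) (by simp [rect])).symm⟩
    · exact n3 ⟨_, _, ⟨rfl, rfl⟩, hadj _ (by simp [rect]) (by simp [rect])⟩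
    · exact n4 ⟨_, _, ⟨rfl, rfl⟩, (hadj _ (by simp [rect]) (by simp [rect])).symm⟩

/-- None of the four rectangles that make up the annulus `Λ_{3n} \ Λ_n` is crossed in the short
direction. -/
def annulusBlocked (n : ℤ) : Set Config :=
  ((hcross (n + 1) (3 * n) (-(3 * n)) (3 * n))ᶜ ∩
    (hcross (-(3 * n)) (-(n + 1)) (-(3 * n)) (3 * n))ᶜ) ∩
  ((vcross (-(3 * n)) (3 * n) (n + 1) (3 * n))ᶜ ∩
    (vcross (-(3 * n)) (3 * n) (-(3 * n)) (-(n + 1)))ᶜ)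

theorem pow_four_le_pr_annulusBlocked {n : ℤ} {c : ℝ} (hc : 0 ≤ c)
    (h : c ≤ nv (6 * n) (2 * n - 1)) : c ^ 4 ≤ pr (annulusBlocked n) := by
  refine (isDecreasing_compl_hcross _ _ _ _).pow_four_le_pr_inter
    (isDecreasing_compl_hcross _ _ _ _) (isDecreasing_compl_vcross _ _ _ _)
    (isDecreasing_compl_vcross _ _ _ _) hc ?_ ?_ ?_ ?_
  · rw [pr_compl_hcross]; convert h using 2 <;> ring
  · rw [pr_compl_hcross]; convert h using 2 <;> ring
  · rw [pr_compl_vcross]; convert h using 2 <;> ring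
  · rw [pr_compl_vcross]; convert h using 2 <;> ring

theorem dependsOnEdges_annulusBlocked {n : ℤ} (hn : 0 ≤ n) :
    DependsOnEdges (annulusBlocked n) (edgesIn (box (3 * n) \ box n)) := by
  have key : ∀ (a b c d : ℤ) (Q : ℤ × ℤ → ℤ × ℤ → Prop),
      rect a b c d ⊆ box (3 * n) \ box n → DependsOnEdges (connEvent (rect a b c d) Q)ᶜ
        (edgesIn (box (3 * n) \ box n)) := fun a b c d Q h =>
    ((dependsOnEdges_connEvent _ Q).mono (edgesIn_mono h)).compl
  have sub : ∀ a b c d : ℤ, (n + 1 ≤ a ∨ b ≤ -(n + 1) ∨ n + 1 ≤ c ∨ d ≤ -(n + 1)) →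
      -(3 * n) ≤ a → b ≤ 3 * n → -(3 * n) ≤ c → d ≤ 3 * n →
      rect a b c d ⊆ box (3 * n) \ box n := by
    rintro a b c d h h1 h2 h3 h4 z ⟨h5, h6⟩
    rw [Set.mem_sdiff, mem_box, mem_box]
    omega
  have := ((key _ _ _ _ (fun u v => u.1 = n + 1 ∧ v.1 = 3 * n)
    (sub (n + 1) (3 * n) (-(3 * n)) (3 * n) (by omega) (by omega) (by omega) (by omega)
      (by omega))).inter (key _ _ _ _ (fun u v => u.1 = -(3 * n) ∧ v.1 = -(n + 1))
    (sub (-(3 * n)) (-(n + 1)) (-(3 * n)) (3 * n) (by omega) (by omega) (by omega) (by omega)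
      (by omega)))).inter ((key _ _ _ _ (fun u v => u.2 = n + 1 ∧ v.2 = 3 * n)
    (sub (-(3 * n)) (3 * n) (n + 1) (3 * n) (by omega) (by omega) (by omega) (by omega)
      (by omega))).inter (key _ _ _ _ (fun u v => u.2 = -(3 * n) ∧ v.2 = -(n + 1))
    (sub (-(3 * n)) (3 * n) (-(3 * n)) (-(n + 1)) (by omega) (by omega) (by omega) (by omega)
      (by omega))))
  rwa [Set.union_self, Set.union_self] at this

theorem arm_three_mul_subset {n : ℤ} (hn : 1 ≤ n) :
    arm (3 * n) ⊆ arm n ∩ (annulusBlocked n)ᶜ := by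
  intro ω hω
  refine ⟨arm_subset_arm hn (by omega) hω, ?_⟩
  rintro ⟨⟨n1, n2⟩, n3, n4⟩
  obtain ⟨u, v, ⟨rfl, hv, hv'⟩, h⟩ := hω
  rw [mem_box] at hv hv'
  have hb : ∀ z ∈ box (3 * n), (-(3 * n) ≤ z.1 ∧ z.1 ≤ 3 * n) ∧ -(3 * n) ≤ z.2 ∧ z.2 ≤ 3 * n :=
    fun z hz => mem_box.1 hz
  have hcases : 3 * n ≤ v.1 ∨ v.1 ≤ -(3 * n) ∨ 3 * n ≤ v.2 ∨ v.2 ≤ -(3 * n) := by omega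
  rcases hcases with c | c | c | c
  · exact n1 (mem_hcross_of_connIn h (fun z hz => (hb z hz).2) (by omega) (by simp only; omega) c)
  · exact n2 (mem_hcross_of_connIn h.symm (fun z hz => (hb z hz).2) (by omega) c
      (by simp only; omega))
  · exact n3 (mem_vcross_of_connIn h (fun z hz => (hb z hz).1) (by omega) (by simp only; omega) c)
  · exact n4 (mem_vcross_of_connIn h.symm (fun z hz => (hb z hz).1) (by omega) c
      (by simp only; omega))

theorem pr_arm_three_mul_le {n : ℤ} (hn : 1 ≤ n) {c : ℝ} (hc : 0 ≤ c)
    (h : c ≤ nv (6 * n) (2 * n - 1)) : pr (arm (3 * n)) ≤ (1 - c ^ 4) * pr (arm n) := by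
  have hfin : (edgesIn (box (3 * n) \ box n)).Finite :=
    edgesIn_finite ((box_finite _).subset Set.sdiff_subset)
  have hdep := dependsOnEdges_annulusBlocked (n := n) (by omega)
  have hmeas := hdep.measurableSet hfin
  have h1 : pr (arm n ∩ (annulusBlocked n)ᶜ) = pr (arm n) * pr (annulusBlocked n)ᶜ :=
    (dependsOnEdges_connEvent (box n) _).measureReal_inter half hdep.compl
      (edgesIn_finite (box_finite n)) hfin (disjoint_edgesIn Set.disjoint_sdiff_right)
  have h2 : pr (annulusBlocked n)ᶜ = 1 - pr (annulusBlocked n) := probReal_compl_eq_one_sub hmeas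
  have h3 := pow_four_le_pr_annulusBlocked hc h
  calc pr (arm (3 * n)) ≤ _ := pr_mono (arm_three_mul_subset hn)
    _ = (1 - pr (annulusBlocked n)) * pr (arm n) := by rw [h1, h2, mul_comm]
    _ ≤ _ := mul_le_mul_of_nonneg_right (by linarith) (pr_nonneg _)

/-- Polynomial decay of the one-arm probability at the self-dual point. -/
theorem exists_pr_arm_le :
    ∃ α : ℝ, 0 < α ∧ ∀ n : ℕ, 1 ≤ n → pr (arm n) ≤ (n : ℝ) ^ (-α) := by
  obtain ⟨c, hc, hcn⟩ := exists_le_nv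
  -- The term `15 / 16` makes `r` positive and bounds the arm probability at every scale from 1 on,
  -- so that no multiplicative constant appears in the final bound.
  set r : ℝ := max (15 / 16) (1 - c ^ 4) with hr
  have hr0 : 0 < r := lt_of_lt_of_le (by norm_num) (le_max_left _ _)
  have hr1 : r < 1 := max_lt (by norm_num) (by have : 0 < c ^ 4 := by positivity
                                               linarith)
  have hbase : ∀ n : ℤ, 1 ≤ n → pr (arm n) ≤ r := fun n hn =>
    (pr_mono (arm_subset_arm le_rfl hn)).trans (pr_arm_one.trans (le_max_left _ _))
  have hscale : ∀ j : ℕ, pr (arm (8 * 3 ^ j)) ≤ r ^ (j + 1) := by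
    intro j
    induction j with
    | zero => simpa using hbase 8 (by norm_num)
    | succ j ih =>
      have h8 : (8 : ℤ) ≤ 8 * 3 ^ j := by
        have : (1 : ℤ) ≤ 3 ^ j := one_le_pow₀ (by norm_num)
        omega
      have := pr_arm_three_mul_le (by omega) hc.le (hcn _ h8)
      rw [show (8 : ℤ) * 3 ^ (j + 1) = 3 * (8 * 3 ^ j) by ring, pow_succ' r]
      exact this.trans (mul_le_mul (le_max_right _ _) ih (pr_nonneg _) hr0.le)
  have hlog : 0 < Real.log 24 := Real.log_pos (by norm_num)
  refine ⟨-Real.log r / Real.log 24, div_pos (neg_pos.2 (Real.log_neg hr0 hr1)) hlog,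
    fun n hn => ?_⟩
  have h24 : (24 : ℝ) ^ (-(-Real.log r / Real.log 24)) = r := by
    rw [Real.rpow_def_of_pos (by norm_num), ← neg_div, neg_neg, mul_div_cancel₀ _ hlog.ne',
      Real.exp_log hr0]
  -- Base 24 absorbs the initial scale: `8 * 3 ^ j ≤ 24 ^ j` for `j ≥ 1`. The bound `r ^ (j + 1)` is
  -- the required power of `24 ^ (j + 1)`, which exceeds `n`.
  set j := Nat.log 24 n
  have hle : 24 ^ j ≤ n := Nat.pow_log_le_self 24 (by omega)
  have hlt : n < 24 ^ (j + 1) := Nat.lt_pow_succ_log_self (by norm_num) n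
  have hq : pr (arm n) ≤ r ^ (j + 1) := by
    rcases Nat.eq_zero_or_pos j with h0 | h0
    · rw [h0]
      simpa using hbase n (by omega)
    · refine (pr_mono (arm_subset_arm ?_ ?_)).trans (hscale j)
      · have : (1 : ℤ) ≤ 3 ^ j := one_le_pow₀ (by norm_num)
        omega
      · have h1 : 8 * 3 ^ j ≤ 24 ^ j := by
          rw [show 24 = 8 * 3 by norm_num, mul_pow]
          exact Nat.mul_le_mul_right _ (Nat.le_self_pow (by omega) 8)
        exact_mod_cast h1.trans hle
  refine hq.trans ?_
  calc r ^ (j + 1) = ((24 : ℝ) ^ (j + 1)) ^ (-(-Real.log r / Real.log 24)) := by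
        rw [← Real.rpow_natCast, ← Real.rpow_natCast, ← Real.rpow_mul (by norm_num),
          mul_comm ((j + 1 : ℕ) : ℝ), Real.rpow_mul (by norm_num), h24]
    _ ≤ _ := by
        refine Real.rpow_le_rpow_of_nonpos (by exact_mod_cast hn) (by exact_mod_cast hlt.le) ?_
        rw [neg_div, neg_neg]
        exact div_nonpos_of_nonpos_of_nonneg (Real.log_neg hr0 hr1).le hlog.le

/-! ### Absence of an infinite cluster -/

theorem existsInfiniteCluster_subset :
    existsInfiniteCluster ⊆ ⋃ x : ℤ × ℤ, ⋂ n : ℕ, pull (shift x) ⁻¹' arm (n + 1) := by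
  rintro ω ⟨C, hC⟩
  obtain ⟨x, hx⟩ := hC.nonempty
  refine Set.mem_iUnion.2 ⟨x, Set.mem_iInter.2 fun n => ?_⟩
  obtain ⟨y, hy, hy'⟩ := hC.exists_notMem_finite ((box_finite n).image (shift x))
  rw [SimpleGraph.ConnectedComponent.mem_supp_iff] at hx hy
  have hxy : (openGraph ω).Reachable x y :=
    SimpleGraph.ConnectedComponent.eq.1 (hx.trans hy.symm)
  refine mem_arm_of_reachable (v := y - x) (by omega) ?_ ?_
  · refine ConnIn.reachable (A := shift x ⁻¹' Set.univ) ?_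
    rw [connIn_pull_iff]
    have h0 : ((0, 0) : ℤ × ℤ) + x = x := zero_add x
    simpa [h0] using ConnIn.of_reachable hxy
  · rw [add_sub_cancel_right]
    exact fun h => hy' ⟨y - x, h, by simp⟩

/-- Monotonicity in `p` is applied to the arm events, which are measurable as local events; the
infinite-cluster event itself is only covered by a null set. -/
theorem bernoulliPercolation_existsInfiniteCluster_eq_zero {p : I} (hp : p ≤ half) :
    bernoulliPercolation p existsInfiniteCluster = 0 := by
  obtain ⟨α, hα, h⟩ := exists_pr_arm_le
  refine measure_mono_null existsInfiniteCluster_subset (measure_iUnion_null fun x => ?_)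
  have key : ∀ n : ℕ, bernoulliPercolation p (⋂ n : ℕ, pull (shift x) ⁻¹' arm (n + 1)) ≤
      ENNReal.ofReal (((n + 1 : ℕ) : ℝ) ^ (-α)) := by
    intro n
    calc _ ≤ bernoulliPercolation p (pull (shift x) ⁻¹' arm (n + 1)) :=
          measure_mono (Set.iInter_subset _ n)
      _ = bernoulliPercolation p (arm (n + 1)) :=
          measure_pull_preimage p _ (measurableSet_arm _)
      _ ≤ bernoulliPercolation half (arm (n + 1)) :=
          bernoulliPercolation_mono (isUpperSet_connEvent _ _) (measurableSet_arm _) hp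
      _ = ENNReal.ofReal (pr (arm (n + 1))) := by
          rw [pr, measureReal_def, ENNReal.ofReal_toReal (measure_ne_top _ _)]
      _ ≤ _ := ENNReal.ofReal_le_ofReal (by exact_mod_cast h (n + 1) (by omega))
  have hlim : Filter.Tendsto (fun n : ℕ => ENNReal.ofReal (((n + 1 : ℕ) : ℝ) ^ (-α)))
      Filter.atTop (nhds 0) := by
    rw [← ENNReal.ofReal_zero]
    exact ENNReal.tendsto_ofReal (((tendsto_rpow_neg_atTop hα).comp
      tendsto_natCast_atTop_atTop).comp (Filter.tendsto_add_atTop_nat 1))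
  exact le_antisymm (ge_of_tendsto' hlim key) bot_le

end Percolation

theorem mainTheorem7 :
    (∃ α : ℝ, 0 < α ∧ ∀ n : ℕ, 1 ≤ n →
      (Percolation.bernoulliPercolation Percolation.half).real
        (Percolation.connected {(0, 0)} (Percolation.boxBoundary n)) ≤ (n : ℝ) ^ (-α)) ∧
    (∀ᵐ ω ∂(Percolation.bernoulliPercolation Percolation.half),
      ω ∉ Percolation.existsInfiniteCluster) ∧
    (1 / 2 : ℝ) ≤ (Percolation.criticalPoint : ℝ) := by
  refine ⟨?_, ?_, ?_⟩
  · obtain ⟨α, hα, h⟩ := Percolation.exists_pr_arm_le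
    refine ⟨α, hα, fun n hn => ?_⟩
    rw [Percolation.connected_boxBoundary_eq_arm (by omega)]
    exact h n hn
  · rw [MeasureTheory.ae_iff]
    simpa using Percolation.bernoulliPercolation_existsInfiniteCluster_eq_zero le_rfl
  · have h : Percolation.half ≤ Percolation.criticalPoint := by
      refine le_sInf fun p hp => ?_
      by_contra hlt
      have h0 : 0 < Percolation.bernoulliPercolation p Percolation.existsInfiniteCluster := hp
      exact h0.ne' (Percolation.bernoulliPercolation_existsInfiniteCluster_eq_zero
        (not_le.1 hlt).le)
    exact h
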